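/- Let $T=\{T(x):x\in S^2\}$ be a real random field on the unit sphere, jointly measurable in $(x,\omega)$. Its harmonic coefficients are $a_{lm}=\int_{S^2}T(x)\overline{Y_{lm}(x)}\,dx$ ($l\ge 0$, $-l\le m\le l$), where $Y_{lm}$ are the usual spherical harmonics and $dx$ is the surface measure. If $E|a_{lm}|^p<\infty$ for all $l,m$, the cumulant polyspectrum of $T$ of order $p-1$ ($p\ge 2$) consists of the vectors $S^c_{l_1\dots l_p}=\big(\mathrm{Cum}\{a_{l_1m_1},\dots,a_{l_pm_p}\}\big)_{|m_i|\le l_i}$. Let $C_{l_1m_1l_2m_2}^{lm}$ be the Clebsch--Gordan coefficients of $SO(3)$ and $$C_{l_1m_1\dots l_{p-1}m_{p-1}}^{\lambda_1\dots\lambda_{p-3}\,l_p,-m_p}=\sum_{\mu_1,\dots,\mu_{p-3}}C_{l_1m_1l_2m_2}^{\lambda_1\mu_1}C_{\lambda_1\mu_1l_3m_3}^{\lambda_2\mu_2}\cdots C_{\lambda_{p-3}\mu_{p-3}l_{p-1}m_{p-1}}^{l_p,-m_p}$$ (for $p=3$ this is $C_{l_1m_1l_2m_2}^{l_3,-m_3}$;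 for $p=2$ it is $\delta_{l_1}^{l_2}\delta_{m_1}^{-m_2}$). Call $(\lambda_1,\dots,\lambda_{p-3})$ admissible for $l_1,\dots,l_p$ if $|l_2-l_1|\le\lambda_1\le l_2+l_1$ and $|l_{k+1}-\lambda_{k-1}|\le\lambda_k\le l_{k+1}+\lambda_{k-1}$ for $2\le k\le p-2$, where $\lambda_{p-2}:=l_p$ (for $p=3$: $|l_2-l_1|\le l_3\le l_1+l_2$; for $p=2$: $l_1=l_2$). A reduced cumulant polyspectrum of $T$ is a real array $A_{l_1\dots l_p}(\lambda_1,\dots,\lambda_{p-3})$ such that, for all $l_i\geq 0$ and $|m_i|\le l_i$, $$\mathrm{Cum}\{a_{l_1m_1},\dots,a_{l_pm_p}\}=(-1)^{m_p}\sum_{\lambda}C_{l_1m_1\dots l_{p-1}m_{p-1}}^{\lambda_1\dots\lambda_{p-3}\,l_p,-m_p}\,A_{l_1\dots l_p}(\lambda_1,\dots,\lambda_{p-3}),\qquad(*)$$ the sum running over the admissible $\lambda$. For every $T$ with finite spectral moments of order $p$ put $$P^C_{l_1\dots l_p}(\lambda)=\frac{1}{2l_p+1}\sum_{m_1,\dots,m_p}(-1)^{m_p}\,C_{l_1m_1\dots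 l_{p-1}m_{p-1}}^{\lambda_1\dots\lambda_{p-3}\,l_p,-m_p}\,\mathrm{Cum}\{a_{l_1m_1},\dots,a_{l_pm_p}\},$$ the coefficients of $S^c_{l_1\dots l_p}$ along the vectors occurring in $(*)$. **Proposition.** Let $\nu\ge 1$, let $T_1,\dots,T_\nu$ be i.i.d. centered (strongly) isotropic Gaussian fields on $S^2$, and let $T_{\chi^2_\nu}$ be a field with the law (finite-dimensional distributions) of $T_1^2+\dots+T_\nu^2$. Let $T_G$ be a centered isotropic Gaussian field with the common law of the $T_i$, and let $F$ be the $\chi^2_1$ field $T_G^2$ or the field $H_2(T_G)=T_G^2-1$. Then, for every $p\ge 2$, $F$ and $T_{\chi^2_\nu}$ have finite spectral moments of order $p$, and: 1. $S^c_{l_1\dots l_p}(T_{\chi^2_\nu})=\nu\,S^c_{l_1\dots l_p}(F)$ for all $l_1,\dots,l_p\ge 0$; 2. the coefficients $P^{C;\nu}$ of $T_{\chi^2_\nu}$ and $P^{C;1}$ of $F$ satisfy $P^{C;\nu}_{l_1\dots l_p}(\lambda_1,\dots,\lambda_{p-3})=\nu\,P^{C;1}_{l_1\dots l_p}(\lambda_1,\dots,\lambda_{p-3})$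 for all $l_1,\dots,l_p$ and all admissible $\lambda$; 3. a real array $A$ is a reduced cumulant polyspectrum of $F$ if and only if $\nu A$ is one of $T_{\chi^2_\nu}$; and if $A$ and $B$ are reduced cumulant polyspectra of $F$ and of $T_{\chi^2_\nu}$, then $B_{l_1\dots l_p}(\lambda_1,\dots,\lambda_{p-3})=\nu\,A_{l_1\dots l_p}(\lambda_1,\dots,\lambda_{p-3})$ for all $l_1,\dots,l_p$ and all admissible $\lambda$. -/

import Mathlib

open MeasureTheory ProbabilityTheory Polynomial

namespace ChiSquarePolyspectra

noncomputable section

/-! ### Random fields on the sphere -/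

/-- Euclidean space `ℝ³`. -/
abbrev E3 : Type := EuclideanSpace ℝ (Fin 3)

/-- The unit sphere `S² ⊆ ℝ³`. -/
abbrev S2 : Type := Metric.sphere (0 : E3) 1

/-- The Lebesgue (surface) measure `dx` on `S²`, of total mass `4π`. -/
def surfaceMeasure : Measure S2 := (volume : Measure E3).toSphere

/-- The image of a point of the sphere under a linear isometry of `ℝ³`. -/
def moveBy (g : E3 ≃ₗᵢ[ℝ] E3) (x : S2) : S2 :=
  ⟨g x, by simp⟩

/-- Equality in law of two random fields on `S²` (possibly living on different probability spaces):
equality of all finite-dimensional distributions. -/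
def EqualInLaw {Ω Ω' : Type*} [MeasurableSpace Ω] [MeasurableSpace Ω']
    (T : S2 → Ω → ℝ) (μ : Measure Ω) (T' : S2 → Ω' → ℝ) (μ' : Measure Ω') : Prop :=
  ∀ (k : ℕ) (x : Fin k → S2),
    IdentDistrib (fun ω i => T (x i) ω) (fun ω i => T' (x i) ω) μ μ'

/-- Strong isotropy: the finite-dimensional distributions are invariant under every rotation
`g ∈ SO(3)`, i.e. under every linear isometry of `ℝ³` of determinant `1`. -/
def StronglyIsotropic {Ω : Type*} [MeasurableSpace Ω] (T : S2 → Ω → ℝ) (μ : Measure Ω) : Prop :=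
  ∀ g : E3 ≃ₗᵢ[ℝ] E3, LinearMap.det (g.toLinearEquiv : E3 →ₗ[ℝ] E3) = 1 →
    EqualInLaw T μ (fun x => T (moveBy g x)) μ

/-- A centered isotropic Gaussian random field on `S²`, measurable as a function of `(x, ω)`. -/
structure IsIsotropicGaussianField {Ω : Type*} [MeasurableSpace Ω]
    (T : S2 → Ω → ℝ) (μ : Measure Ω) : Prop where
  measurable : Measurable (fun q : S2 × Ω => T q.1 q.2)
  gaussian : IsGaussianProcess T μ
  centered : ∀ x, ∫ ω, T x ω ∂μ = 0
  isotropic : StronglyIsotropic T μ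

/-! ### Spherical harmonics and harmonic coefficients -/

/-- The Legendre polynomial `P_l`, by Rodrigues' formula. -/
def legendre (l : ℕ) : ℝ[X] :=
  C (1 / (2 ^ l * (l.factorial : ℝ))) * derivative^[l] ((X ^ 2 - 1) ^ l)

/-- The associated Legendre function
`P_{lm}(t) = (-1)^m (1 - t²)^{m/2} (d/dt)^m P_l(t)`, for `-1 ≤ t ≤ 1` and `m ≥ 0`. -/
def assocLegendre (l m : ℕ) (t : ℝ) : ℝ :=
  (-1) ^ m * Real.sqrt (1 - t ^ 2) ^ m * (derivative^[m] (legendre l)).eval t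

/-- The spherical harmonic `Y_{lm}` with `0 ≤ m ≤ l`. The spherical coordinates of the point `x`
are `cos θ = x 2` and `φ = arg (x 0 + i x 1)`. -/
def sphericalHarmonicNonneg (l m : ℕ) (x : S2) : ℂ :=
  (Real.sqrt ((2 * l + 1) / (4 * Real.pi) *
      (((l - m).factorial : ℝ) / ((l + m).factorial : ℝ))) : ℂ)
    * (assocLegendre l m (x.1 2) : ℂ)
    * Complex.exp (Complex.I * m * Complex.arg ⟨x.1 0, x.1 1⟩)

/-- The spherical harmonic `Y_{lm}`, `-l ≤ m ≤ l`; for `m < 0` it is `(-1)^m` times the conjugate of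
`Y_{l,-m}`. -/
def sphericalHarmonic (l : ℕ) (m : ℤ) (x : S2) : ℂ :=
  if 0 ≤ m then sphericalHarmonicNonneg l m.natAbs x
  else (-1) ^ m.natAbs * (starRingEnd ℂ) (sphericalHarmonicNonneg l m.natAbs x)

/-- The random harmonic coefficient `a_{lm} = ∫_{S²} T(x) conj(Y_{lm}(x)) dx`. -/
def harmonicCoeff {Ω : Type*} (T : S2 → Ω → ℝ) (l : ℕ) (m : ℤ) (ω : Ω) : ℂ :=
  ∫ x, (T x ω : ℂ) * (starRingEnd ℂ) (sphericalHarmonic l m x) ∂surfaceMeasure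

/-- Finite spectral moments of order `p`: `E|a_{lm}|^p < ∞` for all `l ≥ 0`, `-l ≤ m ≤ l`. -/
def FiniteSpectralMoments {Ω : Type*} [MeasurableSpace Ω]
    (T : S2 → Ω → ℝ) (μ : Measure Ω) (p : ℕ) : Prop :=
  ∀ (l : ℕ) (m : ℤ), |m| ≤ l → MemLp (harmonicCoeff T l m) p μ

/-! ### Cumulant polyspectra -/

/-- The joint cumulant of `X_1, …, X_p`, as a sum over the partitions of `{1, …, p}`. -/
def jointCumulant {Ω : Type*} [MeasurableSpace Ω] (μ : Measure Ω) {p : ℕ}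
    (X : Fin p → Ω → ℂ) : ℂ :=
  ∑ π : Finpartition (Finset.univ : Finset (Fin p)),
    (-1) ^ (π.parts.card - 1) * ((π.parts.card - 1).factorial : ℂ) *
      ∏ b ∈ π.parts, ∫ ω, ∏ i ∈ b, X i ω ∂μ

/-- The cumulant polyspectrum of order `p - 1`: the vector `S^c_{l_1 … l_p}`, whose entry of index
`(m_1, …, m_p)` is `Cum{a_{l_1 m_1}, …, a_{l_p m_p}}`. -/
def cumulantPolyspectrum {Ω : Type*} [MeasurableSpace Ω] (T : S2 → Ω → ℝ) (μ : Measure Ω)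
    {p : ℕ} (l : Fin p → ℕ) (m : Fin p → ℤ) : ℂ :=
  jointCumulant μ (fun i => harmonicCoeff T (l i) (m i))

/-! ### Clebsch-Gordan coefficients -/

/-- The triangle conditions `|a - b| ≤ c ≤ a + b`. -/
def Triangle (a b c : ℕ) : Prop := a ≤ b + c ∧ b ≤ a + c ∧ c ≤ a + b

/-- `1 / n!`, with the value `0` for `n < 0`. -/
def invFactorial (n : ℤ) : ℝ := if 0 ≤ n then 1 / (n.toNat.factorial : ℝ) else 0

open Classical in
/-- The Clebsch-Gordan coefficient `C_{l₁ m₁ l₂ m₂}^{l m}` of `SO(3)`, by Racah's closed formula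
(with the usual Condon-Shortley phases). It vanishes unless `m = m₁ + m₂` and the triangle
conditions hold. -/
def clebschGordan (l₁ : ℕ) (m₁ : ℤ) (l₂ : ℕ) (m₂ : ℤ) (l : ℕ) (m : ℤ) : ℝ :=
  if Triangle l₁ l₂ l ∧ |m₁| ≤ l₁ ∧ |m₂| ≤ l₂ ∧ |m| ≤ l ∧ m = m₁ + m₂ then
    Real.sqrt ((2 * l + 1) * ((l₁ + l₂ - l).factorial * (l₁ + l - l₂).factorial *
        (l₂ + l - l₁).factorial : ℝ) / ((l₁ + l₂ + l + 1).factorial : ℝ)) *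
    Real.sqrt ((l + m).toNat.factorial * (l - m).toNat.factorial *
        (l₁ + m₁).toNat.factorial * (l₁ - m₁).toNat.factorial *
        (l₂ + m₂).toNat.factorial * (l₂ - m₂).toNat.factorial) *
    ∑ k ∈ Finset.range (l₁ + l₂ + 1), (-1) ^ k * (invFactorial k *
        invFactorial ((l₁ : ℤ) + l₂ - l - k) * invFactorial (l₁ - m₁ - k) *
        invFactorial (l₂ + m₂ - k) * invFactorial ((l : ℤ) - l₂ + m₁ + k) *
        invFactorial ((l : ℤ) - l₁ - m₂ + k))
  else 0

/-- The angular momentum reached after coupling `l_1, …, l_{n+1}` along `λ_1, …, λ_n`: it is `λ_n`,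
and `l_1` if `n = 0`. -/
def endMomentum : (n : ℕ) → (Fin (n + 1) → ℕ) → (Fin n → ℕ) → ℕ
  | 0, l, _ => l 0
  | n + 1, _, lam => lam (Fin.last n)

/-- The generalized Clebsch-Gordan coefficient
`C_{l_1 m_1 … l_{n+1} m_{n+1}}^{λ_1 … λ_n, μ}`, i.e. the convolution
`∑_{μ_1 … μ_{n-1}} C_{l_1 m_1 l_2 m_2}^{λ_1 μ_1} C_{λ_1 μ_1 l_3 m_3}^{λ_2 μ_2} ⋯
C_{λ_{n-1} μ_{n-1} l_{n+1} m_{n+1}}^{λ_n μ}`. -/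
def genClebschGordan : (n : ℕ) → (Fin (n + 1) → ℕ) → (Fin (n + 1) → ℤ) → (Fin n → ℕ) → ℤ → ℝ
  | 0, _, m, _, μ => if μ = m 0 then 1 else 0
  | n + 1, l, m, lam, μ =>
      ∑ μ' ∈ Finset.Icc (-(endMomentum n (Fin.init l) (Fin.init lam) : ℤ))
          (endMomentum n (Fin.init l) (Fin.init lam)),
        genClebschGordan n (Fin.init l) (Fin.init m) (Fin.init lam) μ' *
          clebschGordan (endMomentum n (Fin.init l) (Fin.init lam)) μ'
            (l (Fin.last (n + 1))) (m (Fin.last (n + 1))) (lam (Fin.last n)) μ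

/-- The range of the indices `λ_1, …, λ_n` in the coupling of `l_1, …, l_{n+1}`:
`|l_2 - l_1| ≤ λ_1 ≤ l_2 + l_1` and `|l_{k+1} - λ_{k-1}| ≤ λ_k ≤ l_{k+1} + λ_{k-1}`. -/
def CouplingPath : (n : ℕ) → (Fin (n + 1) → ℕ) → (Fin n → ℕ) → Prop
  | 0, _, _ => True
  | n + 1, l, lam => CouplingPath n (Fin.init l) (Fin.init lam) ∧
      Triangle (endMomentum n (Fin.init l) (Fin.init lam)) (l (Fin.last (n + 1)))
        (lam (Fin.last n))

/-! ### Reduced cumulant polyspectra -/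

/-- The last entry of a tuple. -/
def lastEntry {α : Type*} [Zero α] : (p : ℕ) → (Fin p → α) → α
  | 0, _ => 0
  | n + 1, f => f (Fin.last n)

/-- The coefficient `C_{l_1 m_1 … l_{p-1} m_{p-1}}^{λ_1 … λ_{p-3} l_p, -m_p}`. For `p = 2` nothing
is coupled and this is `δ_{l_1}^{l_2} δ_{m_1}^{-m_2}`. (Only `p ≥ 2` is meaningful.) -/
def polyCoupling : (p : ℕ) → (Fin p → ℕ) → (Fin p → ℤ) → (Fin (p - 3) → ℕ) → ℝ
  | 0, _, _, _ => 0
  | 1, _, _, _ => 0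
  | 2, l, m, _ => if l 0 = l 1 ∧ m 0 = -m 1 then 1 else 0
  | k + 3, l, m, lam =>
      genClebschGordan (k + 1) (Fin.init l) (Fin.init m)
        (Fin.snoc (α := fun _ => ℕ) lam (l (Fin.last (k + 2)))) (-m (Fin.last (k + 2)))

/-- The range of the arguments `λ_1, …, λ_{p-3}` of a reduced polyspectrum with indices
`l_1, …, l_p`: the tuples such that `λ_1, …, λ_{p-3}, l_p` is a coupling path for
`l_1, …, l_{p-1}`. -/
def Admissible : (p : ℕ) → (Fin p → ℕ) → (Fin (p - 3) → ℕ) → Prop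
  | 0, _, _ => False
  | 1, _, _ => False
  | 2, l, _ => l 0 = l 1
  | k + 3, l, lam =>
      CouplingPath (k + 1) (Fin.init l)
        (Fin.snoc (α := fun _ => ℕ) lam (l (Fin.last (k + 2))))

open Classical in
/-- The finite set of admissible tuples (the triangle conditions force `λ_k ≤ l_1 + ⋯ + l_p`). -/
def admissibleSet (p : ℕ) (l : Fin p → ℕ) : Finset (Fin (p - 3) → ℕ) :=
  (Fintype.piFinset fun _ => Finset.range (∑ i, l i + 1)).filter (Admissible p l)

/-- The real array `A_{l_1 … l_p}(λ_1, …, λ_{p-3})` is a reduced cumulant polyspectrum (of order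
`p - 1`) of the field `T`: for all `l_i ≥ 0` and `-l_i ≤ m_i ≤ l_i`,
`Cum{a_{l_1 m_1}, …, a_{l_p m_p}} =
(-1)^{m_p} ∑_λ C_{l_1 m_1 … l_{p-1} m_{p-1}}^{λ_1 … λ_{p-3} l_p, -m_p} A_{l_1 … l_p}(λ)`. -/
def IsReducedCumulantPolyspectrum {Ω : Type*} [MeasurableSpace Ω] (T : S2 → Ω → ℝ)
    (μ : Measure Ω) (p : ℕ) (A : (Fin p → ℕ) → (Fin (p - 3) → ℕ) → ℝ) : Prop :=
  ∀ (l : Fin p → ℕ) (m : Fin p → ℤ), (∀ i, |m i| ≤ l i) →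
    cumulantPolyspectrum T μ l m =
      (-1) ^ (lastEntry p m) *
        ∑ lam ∈ admissibleSet p l, (polyCoupling p l m lam : ℂ) * (A l lam : ℂ)

/-- The reduced cumulant polyspectrum `P^C_{l_1 … l_p}(λ_1, …, λ_{p-3})` of `T`, built from the
cumulant polyspectrum: up to the factor `(2 l_p + 1)⁻¹` it is the scalar product of the vector
`S^c_{l_1 … l_p}` with the vector
`(-1)^{m_p} C_{l_1 m_1 … l_{p-1} m_{p-1}}^{λ_1 … λ_{p-3} l_p, -m_p}`; for distinct admissible `λ`
these vectors are orthogonal, with squared norm `2 l_p + 1`. -/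
def reducedCumulantPolyspectrum {Ω : Type*} [MeasurableSpace Ω] (T : S2 → Ω → ℝ)
    (μ : Measure Ω) (p : ℕ) (l : Fin p → ℕ) (lam : Fin (p - 3) → ℕ) : ℂ :=
  (2 * ((lastEntry p l : ℕ) : ℂ) + 1)⁻¹ *
    ∑ m ∈ Fintype.piFinset fun i => Finset.Icc (-(l i : ℤ)) (l i),
      (-1) ^ (lastEntry p m) * (polyCoupling p l m lam : ℂ) * cumulantPolyspectrum T μ l m

end

end ChiSquarePolyspectra

open MeasureTheory ProbabilityTheory Polynomial

namespace ChiSquarePolyspectra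

/-! ### Partition sums and subset convolution -/

section PartitionSums

variable {α R : Type*} [DecidableEq α] [CommRing R]

/-- The partitions of the finite set `b`, each given as its set of blocks. -/
def setPartitions (b : Finset α) : Finset (Finset (Finset α)) :=
  (Finset.univ : Finset (Finpartition b)).image Finpartition.parts

lemma mem_setPartitions {b : Finset α} {P : Finset (Finset α)} :
    P ∈ setPartitions b ↔ (∀ c ∈ P, c.Nonempty) ∧ (∀ i, i ∈ b ↔ ∃ c ∈ P, i ∈ c) ∧
      ∀ c ∈ P, ∀ d ∈ P, ∀ i, i ∈ c → i ∈ d → c = d := by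
  constructor
  · intro h
    obtain ⟨π, -, rfl⟩ := Finset.mem_image.1 h
    refine ⟨fun c hc => π.nonempty_of_mem_parts hc, fun i => ?_, fun c hc d hd i hic hid => ?_⟩
    · exact ⟨fun hi => π.exists_mem hi, fun ⟨c, hc, hic⟩ => π.le hc hic⟩
    · exact π.eq_of_mem_parts hc hd hic hid
  · rintro ⟨h1, h2, h3⟩
    refine Finset.mem_image.2 ⟨⟨P, ?_, ?_, ?_⟩, Finset.mem_univ _, rfl⟩
    · rw [Finset.supIndep_iff_pairwiseDisjoint]
      intro c hc d hd hcd
      exact Finset.disjoint_left.2 fun i hic hid => hcd (h3 c hc d hd i hic hid)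
    · ext i
      rw [h2 i, Finset.mem_sup]
      rfl
    · exact fun h => by simpa using h1 _ h

/-- The contribution of one partition to a cumulant with moment function `M`. -/
def partitionWeight (M : Finset α → R) (P : Finset (Finset α)) : R :=
  (-1) ^ (P.card - 1) * ((P.card - 1).factorial : R) * ∏ c ∈ P, M c

/-- The cumulant of the set function `M`, as a sum over set partitions. -/
def setCumulant (M : Finset α → R) (b : Finset α) : R :=
  ∑ P ∈ setPartitions b, partitionWeight M P

lemma setCumulant_eq_sum_finpartition (M : Finset α → R) (b : Finset α) :
    setCumulant M b = ∑ π : Finpartition b,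
      (-1) ^ (π.parts.card - 1) * ((π.parts.card - 1).factorial : R) * ∏ c ∈ π.parts, M c := by
  rw [setCumulant, setPartitions, Finset.sum_image fun π _ ρ _ h => Finpartition.ext h]
  rfl

lemma sum_setCumulant_ssubset (M : Finset α → R) {b : Finset α} {i₀ : α} (hi₀ : i₀ ∈ b) :
    ∑ c ∈ b.ssubsets with i₀ ∈ c, setCumulant M c * M (b \ c) =
      ∑ Q ∈ setPartitions b, ∑ d ∈ Q with i₀ ∉ d, partitionWeight M (Q.erase d) * M d := by
  simp_rw [setCumulant, Finset.sum_mul]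
  rw [Finset.sum_sigma', Finset.sum_sigma']
  refine Finset.sum_bij' (fun x _ => ⟨insert (b \ x.1) x.2, b \ x.1⟩)
    (fun y _ => ⟨b \ y.2, y.1.erase y.2⟩) ?_ ?_ ?_ ?_ ?_
  · rintro ⟨c, P⟩ h
    simp only [Finset.mem_sigma, Finset.mem_filter, Finset.mem_ssubsets, mem_setPartitions] at h ⊢
    obtain ⟨⟨hcb, hic⟩, h1, h2, h3⟩ := h
    refine ⟨⟨?_, ?_, ?_⟩, Finset.mem_insert_self _ _, ?_⟩
    · intro e he
      rcases Finset.mem_insert.1 he with rfl | he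
      · exact Finset.sdiff_nonempty.2 hcb.2
      · exact h1 e he
    · intro i
      have := @hcb.1 i
      simp only [Finset.mem_insert, exists_eq_or_imp, Finset.mem_sdiff, ← h2 i]
      tauto
    · have key : ∀ e ∈ P, ∀ i, i ∈ e → i ∉ b \ c := fun e he i hie hi =>
        (Finset.mem_sdiff.1 hi).2 ((h2 i).2 ⟨e, he, hie⟩)
      intro e he f hf i hie hif
      rcases Finset.mem_insert.1 he with rfl | he <;> rcases Finset.mem_insert.1 hf with rfl | hf
      · rfl
      · exact absurd hie (key f hf i hif)
      · exact absurd hif (key e he i hie)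
      · exact h3 e he f hf i hie hif
    · simp [hic]
  · rintro ⟨Q, d⟩ h
    simp only [Finset.mem_sigma, Finset.mem_filter, Finset.mem_ssubsets, mem_setPartitions] at h ⊢
    obtain ⟨⟨h1, h2, h3⟩, hd, hid⟩ := h
    have hdb : d ⊆ b := fun i hi => (h2 i).2 ⟨d, hd, hi⟩
    refine ⟨⟨Finset.sdiff_ssubset hdb (h1 d hd), Finset.mem_sdiff.2 ⟨hi₀, hid⟩⟩, ?_, ?_, ?_⟩
    · exact fun c hc => h1 c (Finset.mem_of_mem_erase hc)
    · intro i
      simp only [Finset.mem_sdiff, Finset.mem_erase]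
      constructor
      · rintro ⟨hib, hi⟩
        obtain ⟨c, hc, hic⟩ := (h2 i).1 hib
        exact ⟨c, ⟨fun hcd => hi (hcd ▸ hic), hc⟩, hic⟩
      · rintro ⟨c, ⟨hcd, hc⟩, hic⟩
        exact ⟨(h2 i).2 ⟨c, hc, hic⟩, fun hi => hcd (h3 c hc d hd i hic hi)⟩
    · exact fun c hc e he => h3 c (Finset.mem_of_mem_erase hc) e (Finset.mem_of_mem_erase he)
  · rintro ⟨c, P⟩ h
    simp only [Finset.mem_sigma, Finset.mem_filter, Finset.mem_ssubsets, mem_setPartitions] at h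
    obtain ⟨⟨hcb, hic⟩, h1, h2, h3⟩ := h
    have hn : b \ c ∉ P := fun hP => by
      obtain ⟨i, hi⟩ := h1 _ hP
      exact (Finset.mem_sdiff.1 hi).2 ((h2 i).2 ⟨_, hP, hi⟩)
    simp only [Finset.erase_insert hn, Finset.sdiff_sdiff_eq_self hcb.1]
  · rintro ⟨Q, d⟩ h
    simp only [Finset.mem_sigma, Finset.mem_filter, mem_setPartitions] at h
    obtain ⟨⟨h1, h2, h3⟩, hd, hid⟩ := h
    have hdb : d ⊆ b := fun i hi => (h2 i).2 ⟨d, hd, hi⟩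
    simp only [Finset.sdiff_sdiff_eq_self hdb, Finset.insert_erase hd]
  · rintro ⟨c, P⟩ h
    simp only [Finset.mem_sigma, Finset.mem_filter, Finset.mem_ssubsets, mem_setPartitions] at h
    obtain ⟨⟨hcb, hic⟩, h1, h2, h3⟩ := h
    have hn : b \ c ∉ P := fun hP => by
      obtain ⟨i, hi⟩ := h1 _ hP
      exact (Finset.mem_sdiff.1 hi).2 ((h2 i).2 ⟨_, hP, hi⟩)
    simp only [Finset.erase_insert hn]

lemma partitionWeight_add_sum_erase (M : Finset α → R) {b : Finset α} {i₀ : α} (hi₀ : i₀ ∈ b)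
    {Q : Finset (Finset α)} (hQ : Q ∈ setPartitions b) :
    partitionWeight M Q + ∑ d ∈ Q with i₀ ∉ d, partitionWeight M (Q.erase d) * M d =
      if Q = {b} then M b else 0 := by
  obtain ⟨h1, h2, h3⟩ := mem_setPartitions.1 hQ
  obtain ⟨c₀, hc₀, hic₀⟩ := (h2 i₀).1 hi₀
  have hfilter : Q.filter (i₀ ∉ ·) = Q.erase c₀ := by
    ext d
    simp only [Finset.mem_filter, Finset.mem_erase]
    constructor
    · rintro ⟨hd, hid⟩
      exact ⟨fun h => hid (h ▸ hic₀), hd⟩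
    · rintro ⟨hd, hdQ⟩
      exact ⟨hdQ, fun hid => hd (h3 d hdQ c₀ hc₀ i₀ hid hic₀)⟩
  have hsum : ∑ d ∈ Q with i₀ ∉ d, partitionWeight M (Q.erase d) * M d =
      ((Q.card - 1 : ℕ) : R) * ((-1) ^ (Q.card - 1 - 1) * ((Q.card - 1 - 1).factorial : R) *
        ∏ c ∈ Q, M c) := by
    rw [hfilter, ← Finset.card_erase_of_mem hc₀, ← nsmul_eq_mul, ← Finset.sum_const]
    refine Finset.sum_congr rfl fun d hd => ?_
    have hdQ := Finset.mem_of_mem_erase hd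
    rw [partitionWeight, Finset.card_erase_of_mem hdQ, Finset.card_erase_of_mem hc₀, mul_assoc,
      Finset.prod_erase_mul _ _ hdQ]
  rw [hsum, partitionWeight]
  obtain ⟨n, hn⟩ : ∃ n, Q.card = n + 1 :=
    ⟨Q.card - 1, (Nat.succ_pred_eq_of_pos (Finset.card_pos.2 ⟨c₀, hc₀⟩)).symm⟩
  rcases n with _ | k
  · obtain ⟨d, rfl⟩ := Finset.card_eq_one.1 hn
    have hdb : d = b := by
      ext i
      simpa using (h2 i).symm
    simp [hdb]
  · have hne : Q ≠ {b} := by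
      rintro rfl
      simp at hn
    rw [if_neg hne, hn]
    simp only [Nat.add_sub_cancel, Nat.factorial_succ, pow_succ]
    push_cast
    ring

lemma singleton_mem_setPartitions {b : Finset α} (hb : b.Nonempty) : {b} ∈ setPartitions b := by
  simp [mem_setPartitions, hb]

/-- The moment-cumulant recursion. -/
lemma sum_setCumulant_mul_sdiff {M : Finset α → R} (hM : M ∅ = 1) {b : Finset α} {i₀ : α}
    (hi₀ : i₀ ∈ b) :
    ∑ c ∈ b.powerset with i₀ ∈ c, setCumulant M c * M (b \ c) = M b := by
  have hsplit : b.powerset.filter (i₀ ∈ ·) = insert b (b.ssubsets.filter (i₀ ∈ ·)) := by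
    ext c
    simp only [Finset.mem_filter, Finset.mem_powerset, Finset.mem_insert, Finset.mem_ssubsets]
    constructor
    · rintro ⟨hc, hic⟩
      exact hc.eq_or_ssubset.imp_right fun h => ⟨h, hic⟩
    · rintro (rfl | ⟨hc, hic⟩)
      · exact ⟨subset_rfl, hi₀⟩
      · exact ⟨hc.1, hic⟩
  rw [hsplit, Finset.sum_insert (by simp), sum_setCumulant_ssubset M hi₀, Finset.sdiff_self,
    hM, mul_one, setCumulant, ← Finset.sum_add_distrib,
    Finset.sum_congr rfl fun Q hQ => partitionWeight_add_sum_erase M hi₀ hQ,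
    Finset.sum_ite_eq' , if_pos (singleton_mem_setPartitions ⟨i₀, hi₀⟩)]

/-- The moment-cumulant recursion determines the cumulants. -/
lemma eq_setCumulant_of_recursion {M κ : Finset α → R} (hM : M ∅ = 1)
    (h : ∀ (b : Finset α), ∀ i₀ ∈ b, ∑ c ∈ b.powerset with i₀ ∈ c, κ c * M (b \ c) = M b)
    {b : Finset α} (hb : b.Nonempty) : κ b = setCumulant M b := by
  induction b using Finset.strongInduction with
  | H b ih =>
    obtain ⟨i₀, hi₀⟩ := hb
    have hmem : b ∈ b.powerset.filter (i₀ ∈ ·) := by simp [hi₀]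
    have h1 := h b i₀ hi₀
    rw [← sum_setCumulant_mul_sdiff hM hi₀, ← Finset.sum_erase_add _ _ hmem,
      ← Finset.sum_erase_add _ _ hmem] at h1
    simp only [Finset.sdiff_self, hM, mul_one] at h1
    rw [Finset.sum_congr rfl fun c hc => ?_] at h1
    · exact add_left_cancel h1
    · simp only [Finset.mem_erase, Finset.mem_filter, Finset.mem_powerset] at hc
      rw [ih c (hc.2.1.ssubset_of_ne hc.1) ⟨i₀, hc.2.2⟩]

lemma sum_sum_powerset_sdiff (b : Finset α) (f : Finset α → Finset α → Finset α → R) :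
    ∑ c ∈ b.powerset, ∑ d ∈ (b \ c).powerset, f c d ((b \ c) \ d) =
      ∑ e ∈ b.powerset, ∑ c ∈ e.powerset, f c (e \ c) (b \ e) := by
  rw [Finset.sum_sigma', Finset.sum_sigma']
  refine Finset.sum_bij' (fun x _ => ⟨x.1 ∪ x.2, x.1⟩) (fun y _ => ⟨y.2, y.1 \ y.2⟩) ?_ ?_ ?_ ?_ ?_
  · rintro ⟨c, d⟩ h
    simp only [Finset.mem_sigma, Finset.mem_powerset] at h ⊢
    exact ⟨Finset.union_subset h.1 (h.2.trans Finset.sdiff_subset), Finset.subset_union_left⟩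
  · rintro ⟨e, c⟩ h
    simp only [Finset.mem_sigma, Finset.mem_powerset] at h ⊢
    exact ⟨h.2.trans h.1, Finset.sdiff_subset_sdiff h.1 subset_rfl⟩
  · rintro ⟨c, d⟩ h
    simp only [Finset.mem_sigma, Finset.mem_powerset] at h
    have : Disjoint c d := Finset.disjoint_of_subset_right h.2 Finset.disjoint_sdiff
    simp [Finset.union_sdiff_cancel_left this]
  · rintro ⟨e, c⟩ h
    simp only [Finset.mem_sigma, Finset.mem_powerset] at h
    simp [Finset.union_sdiff_of_subset h.2]
  · rintro ⟨c, d⟩ h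
    simp only [Finset.mem_sigma, Finset.mem_powerset] at h
    have : Disjoint c d := Finset.disjoint_of_subset_right h.2 Finset.disjoint_sdiff
    simp only [Finset.union_sdiff_cancel_left this, sdiff_sdiff_left, Finset.sup_eq_union]

/-- Cumulants turn subset convolution into addition. -/
theorem setCumulant_convolution {M M₁ M₂ : Finset α → R} (h₁ : M₁ ∅ = 1) (h₂ : M₂ ∅ = 1)
    (hM : ∀ b, M b = ∑ c ∈ b.powerset, M₁ c * M₂ (b \ c)) {b : Finset α} (hb : b.Nonempty) :
    setCumulant M b = setCumulant M₁ b + setCumulant M₂ b := by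
  have h0 : M ∅ = 1 := by simp [hM, h₁, h₂]
  have hM' : ∀ b, M b = ∑ c ∈ b.powerset, M₂ c * M₁ (b \ c) := by
    intro b
    rw [hM]
    refine Finset.sum_bij' (fun c _ => b \ c) (fun c _ => b \ c) ?_ ?_ ?_ ?_ ?_ <;> intro c hc <;>
      rw [Finset.mem_powerset] at hc
    · simp
    · simp
    · exact Finset.sdiff_sdiff_eq_self hc
    · exact Finset.sdiff_sdiff_eq_self hc
    · rw [Finset.sdiff_sdiff_eq_self hc, mul_comm]
  have key : ∀ (N N₁ N₂ : Finset α → R), N₁ ∅ = 1 →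
      (∀ b, N b = ∑ c ∈ b.powerset, N₁ c * N₂ (b \ c)) → ∀ b, ∀ i₀ ∈ b,
      ∑ c ∈ b.powerset with i₀ ∈ c, setCumulant N₁ c * N (b \ c) =
        ∑ e ∈ b.powerset with i₀ ∈ e, N₁ e * N₂ (b \ e) := by
    intro N N₁ N₂ hN₁ hN b i₀ hi₀
    have := sum_sum_powerset_sdiff b
      (fun c d e => if i₀ ∈ c then setCumulant N₁ c * (N₁ d * N₂ e) else 0)
    rw [Finset.sum_filter, Finset.sum_filter]
    refine (Finset.sum_congr rfl fun c _ => ?_).trans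
      (this.trans (Finset.sum_congr rfl fun e _ => ?_))
    · rw [hN, Finset.mul_sum]
      split_ifs <;> simp
    · split_ifs with hie
      · rw [← sum_setCumulant_mul_sdiff hN₁ hie, Finset.sum_mul, Finset.sum_filter]
        refine Finset.sum_congr rfl fun c _ => ?_
        split_ifs <;> ring
      · refine Finset.sum_eq_zero fun c hc => ?_
        rw [if_neg fun h => hie (Finset.mem_powerset.1 hc h)]
  refine (eq_setCumulant_of_recursion (κ := fun b => setCumulant M₁ b + setCumulant M₂ b) h0
    (fun b i₀ hi₀ => ?_) hb).symm
  simp only [add_mul, Finset.sum_add_distrib]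
  rw [key M M₁ M₂ h₁ hM b i₀ hi₀, key M M₂ M₁ h₂ hM' b i₀ hi₀, hM b,
    ← Finset.sum_filter_add_sum_filter_not b.powerset (i₀ ∈ ·)]
  congr 1
  refine Finset.sum_bij' (fun c _ => b \ c) (fun c _ => b \ c) ?_ ?_ ?_ ?_ ?_ <;> intro c hc <;>
    simp only [Finset.mem_filter, Finset.mem_powerset] at hc ⊢
  · simp [hc.2]
  · simp [hc.2, hi₀]
  · exact Finset.sdiff_sdiff_eq_self hc.1
  · exact Finset.sdiff_sdiff_eq_self hc.1
  · rw [Finset.sdiff_sdiff_eq_self hc.1, mul_comm]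

/-- Cumulants of order at least two of constants vanish. -/
lemma setCumulant_prod_eq_zero [IsDomain R] [CharZero R] (x : α → R) {b : Finset α}
    (hb : 2 ≤ b.card) : setCumulant (fun c => ∏ i ∈ c, x i) b = 0 := by
  have hfactor : ∀ y : α → R, setCumulant (fun c => ∏ i ∈ c, y i) b =
      (∏ i ∈ b, y i) * setCumulant (fun _ => 1) b := by
    intro y
    simp only [setCumulant_eq_sum_finpartition, Finset.mul_sum]
    refine Finset.sum_congr rfl fun π _ => ?_
    have : ∏ c ∈ π.parts, ∏ i ∈ c, y i = ∏ i ∈ b, y i := by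
      conv_rhs => rw [← π.biUnion_parts]
      exact (Finset.prod_biUnion π.disjoint).symm
    rw [this]
    simp [mul_comm]
  have hbne : b.Nonempty := Finset.card_pos.1 (by lia)
  have hadd := setCumulant_convolution (M := fun c => ∏ i ∈ c, ((1 : R) + 1))
    (M₁ := fun c => ∏ i ∈ c, (1 : R)) (M₂ := fun c => ∏ i ∈ c, (1 : R)) (by simp) (by simp)
    (fun c => by rw [Finset.prod_add]) hbne
  have h2 := hfactor fun _ => 1 + 1
  simp only [Finset.prod_const_one, Finset.prod_const] at hadd h2
  rw [hadd] at h2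
  have hpow : ((2 : R) ^ b.card - 2) * setCumulant (fun _ => 1) b = 0 := by
    linear_combination -h2
  have hne : (2 : R) ^ b.card - 2 ≠ 0 := by
    have : (2 : ℕ) ^ b.card ≠ 2 := by
      have := Nat.pow_lt_pow_right (a := 2) (by norm_num) (show 1 < b.card by lia)
      lia
    rw [sub_ne_zero]
    exact_mod_cast this
  rw [hfactor x, (mul_eq_zero.1 hpow).resolve_left hne, mul_zero]

end PartitionSums

/-! ### Linear independence of the Clebsch-Gordan vectors -/

section ClebschGordan

lemma invFactorial_of_neg {n : ℤ} (h : n < 0) : invFactorial n = 0 := if_neg (not_le.2 h)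

lemma invFactorial_pos {n : ℤ} (h : 0 ≤ n) : 0 < invFactorial n := by
  rw [invFactorial, if_pos h]
  positivity

lemma invFactorial_nonneg (n : ℤ) : 0 ≤ invFactorial n := by
  rcases lt_or_ge n 0 with h | h
  · exact (invFactorial_of_neg h).ge
  · exact (invFactorial_pos h).le

lemma invFactorial_natCast (n : ℕ) : invFactorial n = 1 / (n.factorial : ℝ) := by
  simp [invFactorial]

/-- The product of inverse factorials whose iterated difference is Racah's sum. -/
noncomputable def racahKernel (l₁ l₂ L : ℕ) (m y : ℤ) : ℝ :=
  invFactorial (l₁ - y) * invFactorial (l₂ + m - y) * invFactorial ((L : ℤ) - l₂ + y) *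
    invFactorial ((L : ℤ) - l₁ - m + y)

/-- Racah's sum, as a function of `x = m₁` for fixed `m = m₁ + m₂`. -/
noncomputable def racahSum (l₁ l₂ L : ℕ) (m x : ℤ) : ℝ :=
  ∑ k ∈ Finset.range (l₁ + l₂ + 1), (-1) ^ k * (invFactorial k *
    invFactorial ((l₁ : ℤ) + l₂ - L - k)) * racahKernel l₁ l₂ L m (x + k)

lemma racahKernel_eq_zero {l₁ l₂ L : ℕ} {m y : ℤ} (h : y ∉ Finset.Icc ((l₂ : ℤ) - L) l₁) :
    racahKernel l₁ l₂ L m y = 0 := by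
  rw [Finset.mem_Icc, not_and_or, not_le, not_le] at h
  rcases h with h | h
  · simp [racahKernel, invFactorial_of_neg (show (L : ℤ) - l₂ + y < 0 by lia)]
  · simp [racahKernel, invFactorial_of_neg (show (l₁ : ℤ) - y < 0 by lia)]

lemma sum_racahKernel_pos {l₁ l₂ L : ℕ} {m : ℤ} (ht : Triangle l₁ l₂ L) (hm : |m| ≤ L) :
    0 < ∑ y ∈ Finset.Icc ((l₂ : ℤ) - L) l₁, racahKernel l₁ l₂ L m y := by
  obtain ⟨h1, h2, h3⟩ := ht
  rw [abs_le] at hm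
  have hnn : ∀ y, 0 ≤ racahKernel l₁ l₂ L m y := fun y => by
    have := invFactorial_nonneg
    unfold racahKernel
    exact mul_nonneg (mul_nonneg (mul_nonneg (this _) (this _)) (this _)) (this _)
  refine Finset.sum_pos' (fun y _ => hnn y) ⟨min (l₁ : ℤ) (l₂ + m), ?_, ?_⟩
  · rw [Finset.mem_Icc]
    lia
  · unfold racahKernel
    refine mul_pos (mul_pos (mul_pos ?_ ?_) ?_) ?_ <;> exact invFactorial_pos (by lia)

lemma racahSum_eq_zero {l₁ l₂ L : ℕ} {m x : ℤ} (h : (l₂ : ℤ) < |m - x|) :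
    racahSum l₁ l₂ L m x = 0 := by
  refine Finset.sum_eq_zero fun k _ => ?_
  rcases lt_abs.1 h with h | h
  · rcases lt_or_ge ((l₁ : ℤ) + l₂ - L - k) 0 with h' | h'
    · simp [invFactorial_of_neg h']
    · simp [racahKernel, invFactorial_of_neg (show (L : ℤ) - l₁ - m + (x + k) < 0 by lia)]
  · simp [racahKernel, invFactorial_of_neg (show (l₂ : ℤ) + m - (x + k) < 0 by lia)]

lemma sum_mul_racahKernel_shift {l₁ l₂ L k : ℕ} (m : ℤ) (f : ℤ → ℝ) (hk : k + L ≤ l₁ + l₂) :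
    ∑ x ∈ Finset.Icc (-(l₁ : ℤ)) l₁, f x * racahKernel l₁ l₂ L m (x + k) =
      ∑ y ∈ Finset.Icc ((l₂ : ℤ) - L) l₁, f (y - k) * racahKernel l₁ l₂ L m y := by
  symm
  have himage : (Finset.Icc ((l₂ : ℤ) - L) l₁).image (· - (k : ℤ)) ⊆
      Finset.Icc (-(l₁ : ℤ)) l₁ := by
    intro x hx
    obtain ⟨y, hy, rfl⟩ := Finset.mem_image.1 hx
    rw [Finset.mem_Icc] at hy ⊢
    lia
  rw [← Finset.sum_subset himage, Finset.sum_image (fun a _ b _ h => by simpa using h)]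
  · simp
  · intro x _ hx
    rw [racahKernel_eq_zero, mul_zero]
    intro h
    exact hx (Finset.mem_image.2 ⟨_, h, by simp⟩)

lemma sum_alternating_invFactorial_mul_pow (N j : ℕ) (y : ℝ) :
    ∑ k ∈ Finset.range (N + 1), (-1) ^ k * (invFactorial k * invFactorial ((N : ℤ) - k)) *
      (y - k) ^ j = (1 / (N.factorial : ℝ)) * (fwdDiff 1)^[N] (fun x : ℝ => x ^ j) (y - N) := by
  rw [fwdDiff_iter_eq_sum_shift, Finset.mul_sum, ← Finset.sum_range_reflect]
  refine Finset.sum_congr rfl fun k hk => ?_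
  have hk' : k ≤ N := by simpa [Nat.lt_succ_iff] using hk
  have e1 : N + 1 - 1 - k = N - k := by lia
  have e2 : (N : ℤ) - (N - k : ℕ) = (k : ℕ) := by lia
  rw [e1, e2, invFactorial_natCast, invFactorial_natCast, zsmul_eq_mul]
  push_cast [hk']
  rw [Nat.cast_choose ℝ hk', nsmul_eq_mul, mul_one, show y - ((N : ℝ) - k) = y - N + k by ring]
  field_simp

lemma sum_pow_mul_racahSum {l₁ l₂ L N : ℕ} (m : ℤ) (hN : N + L = l₁ + l₂) (j : ℕ) :
    ∑ x ∈ Finset.Icc (-(l₁ : ℤ)) l₁, (x : ℝ) ^ j * racahSum l₁ l₂ L m x =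
      ∑ y ∈ Finset.Icc ((l₂ : ℤ) - L) l₁, (1 / (N.factorial : ℝ)) *
        (fwdDiff 1)^[N] (fun x : ℝ => x ^ j) (y - N) * racahKernel l₁ l₂ L m y := by
  have hS : ∀ x, racahSum l₁ l₂ L m x = ∑ k ∈ Finset.range (N + 1),
      (-1) ^ k * (invFactorial k * invFactorial ((N : ℤ) - k)) *
        racahKernel l₁ l₂ L m (x + k) := by
    intro x
    have e : (l₁ : ℤ) + l₂ - L = N := by lia
    rw [racahSum, e]
    symm
    refine Finset.sum_subset (Finset.range_mono (by lia)) fun k _ hk => ?_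
    rw [Finset.mem_range] at hk
    simp [invFactorial_of_neg (show (N : ℤ) - k < 0 by lia)]
  simp_rw [hS, Finset.mul_sum]
  rw [Finset.sum_comm]
  simp_rw [← sum_alternating_invFactorial_mul_pow, Finset.sum_mul]
  rw [Finset.sum_comm (s := Finset.Icc ((l₂ : ℤ) - L) l₁)]
  refine Finset.sum_congr rfl fun k hk => ?_
  rw [Finset.mem_range] at hk
  have := sum_mul_racahKernel_shift m (fun x : ℤ => (-1) ^ k * (invFactorial k *
    invFactorial ((N : ℤ) - k)) * (x : ℝ) ^ j) (show k + L ≤ l₁ + l₂ by lia)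
  push_cast at this
  rw [← this]
  exact Finset.sum_congr rfl fun x _ => by ring

lemma sum_pow_mul_racahSum_of_lt {l₁ l₂ L j : ℕ} (m : ℤ) (h : j + L < l₁ + l₂) :
    ∑ x ∈ Finset.Icc (-(l₁ : ℤ)) l₁, (x : ℝ) ^ j * racahSum l₁ l₂ L m x = 0 := by
  obtain ⟨N, hN⟩ : ∃ N, N + L = l₁ + l₂ := ⟨l₁ + l₂ - L, by lia⟩
  rw [sum_pow_mul_racahSum m hN, fwdDiff_iter_pow_eq_zero_of_lt (show j < N by lia)]
  simp

lemma sum_pow_mul_racahSum_pos {l₁ l₂ L j : ℕ} {m : ℤ} (ht : Triangle l₁ l₂ L) (hm : |m| ≤ L)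
    (h : j + L = l₁ + l₂) :
    0 < ∑ x ∈ Finset.Icc (-(l₁ : ℤ)) l₁, (x : ℝ) ^ j * racahSum l₁ l₂ L m x := by
  rw [sum_pow_mul_racahSum m h, fwdDiff_iter_eq_factorial]
  have : (j.factorial : ℝ) ≠ 0 := by positivity
  simpa [this, Pi.natCast_apply] using sum_racahKernel_pos ht hm

/-- The factor of the Clebsch-Gordan coefficient which does not depend on `m₁`. -/
noncomputable def clebschGordanNorm (l₁ l₂ L : ℕ) (m : ℤ) : ℝ :=
  Real.sqrt ((2 * L + 1) * ((l₁ + l₂ - L).factorial * (l₁ + L - l₂).factorial *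
      (l₂ + L - l₁).factorial : ℝ) / ((l₁ + l₂ + L + 1).factorial : ℝ)) *
    Real.sqrt ((L + m).toNat.factorial * (L - m).toNat.factorial)

/-- The square root factor of the Clebsch-Gordan coefficient which does not depend on `L`. -/
noncomputable def clebschGordanWeight (l₁ l₂ : ℕ) (m x : ℤ) : ℝ :=
  Real.sqrt ((l₁ + x).toNat.factorial * (l₁ - x).toNat.factorial *
    (l₂ + (m - x)).toNat.factorial * (l₂ - (m - x)).toNat.factorial)

lemma clebschGordanNorm_pos (l₁ l₂ L : ℕ) (m : ℤ) : 0 < clebschGordanNorm l₁ l₂ L m := by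
  unfold clebschGordanNorm
  positivity

lemma clebschGordanWeight_pos (l₁ l₂ : ℕ) (m x : ℤ) : 0 < clebschGordanWeight l₁ l₂ m x := by
  unfold clebschGordanWeight
  positivity

lemma clebschGordan_eq_racahSum {l₁ l₂ L : ℕ} {m x : ℤ} (ht : Triangle l₁ l₂ L) (hm : |m| ≤ L)
    (hx : |x| ≤ l₁) (hmx : |m - x| ≤ l₂) :
    clebschGordan l₁ x l₂ (m - x) L m = clebschGordanWeight l₁ l₂ m x *
      (clebschGordanNorm l₁ l₂ L m * racahSum l₁ l₂ L m x) := by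
  rw [clebschGordan, if_pos ⟨ht, hx, hmx, hm, by ring⟩, clebschGordanWeight, clebschGordanNorm,
    show ((L + m).toNat.factorial * (L - m).toNat.factorial * (l₁ + x).toNat.factorial *
      (l₁ - x).toNat.factorial * (l₂ + (m - x)).toNat.factorial *
      (l₂ - (m - x)).toNat.factorial : ℝ) =
      ((L + m).toNat.factorial * (L - m).toNat.factorial) * ((l₁ + x).toNat.factorial *
      (l₁ - x).toNat.factorial * (l₂ + (m - x)).toNat.factorial *
      (l₂ - (m - x)).toNat.factorial) by ring, Real.sqrt_mul (by positivity)]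
  have hS : racahSum l₁ l₂ L m x = ∑ k ∈ Finset.range (l₁ + l₂ + 1), (-1) ^ k * (invFactorial k *
      invFactorial ((l₁ : ℤ) + l₂ - L - k) * invFactorial (l₁ - x - k) *
      invFactorial (l₂ + (m - x) - k) * invFactorial ((L : ℤ) - l₂ + x + k) *
      invFactorial ((L : ℤ) - l₁ - (m - x) + k)) := by
    refine Finset.sum_congr rfl fun k _ => ?_
    rw [racahKernel, show (l₁ : ℤ) - (x + k) = l₁ - x - k by ring,
      show (l₂ : ℤ) + m - (x + k) = l₂ + (m - x) - k by ring,
      show (L : ℤ) - l₂ + (x + k) = L - l₂ + x + k by ring,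
      show (L : ℤ) - l₁ - m + (x + k) = L - l₁ - (m - x) + k by ring]
    ring
  rw [hS]
  ring

lemma clebschGordan_eq_zero {l₁ l₂ L : ℕ} {m₁ m₂ m : ℤ}
    (h : ¬(Triangle l₁ l₂ L ∧ |m| ≤ L ∧ m = m₁ + m₂)) : clebschGordan l₁ m₁ l₂ m₂ L m = 0 :=
  if_neg fun h' => h ⟨h'.1, h'.2.2.2.1, h'.2.2.2.2⟩

/-- For fixed `m`, the vectors `m₁ ↦ C_{l₁ m₁ l₂ (m - m₁)}^{L m}` are linearly independent. -/
theorem clebschGordan_independent {l₁ l₂ : ℕ} {m : ℤ} (s : Finset ℕ) (c : ℕ → ℝ)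
    (h : ∀ x : ℤ, |x| ≤ l₁ → |m - x| ≤ l₂ →
      ∑ L ∈ s, c L * clebschGordan l₁ x l₂ (m - x) L m = 0)
    {L : ℕ} (hL : L ∈ s) (ht : Triangle l₁ l₂ L) (hm : |m| ≤ L) : c L = 0 := by
  classical
  set t := s.filter fun L => Triangle l₁ l₂ L ∧ |m| ≤ L with htdef
  have hmem : ∀ {L}, L ∈ t ↔ L ∈ s ∧ Triangle l₁ l₂ L ∧ |m| ≤ L := Finset.mem_filter
  have hsum : ∀ x ∈ Finset.Icc (-(l₁ : ℤ)) l₁,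
      ∑ L ∈ t, c L * clebschGordanNorm l₁ l₂ L m * racahSum l₁ l₂ L m x = 0 := by
    intro x hx
    have hx' : |x| ≤ l₁ := abs_le.2 (Finset.mem_Icc.1 hx)
    rcases le_or_gt |m - x| l₂ with hmx | hmx
    · have h0 := h x hx' hmx
      rw [← Finset.sum_filter_of_ne (p := fun L => Triangle l₁ l₂ L ∧ |m| ≤ L)] at h0
      · rw [← htdef, Finset.sum_congr rfl fun L hL => by
          rw [clebschGordan_eq_racahSum (hmem.1 hL).2.1 (hmem.1 hL).2.2 hx' hmx,
            mul_left_comm]] at h0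
        rw [← Finset.mul_sum] at h0
        simpa only [mul_assoc] using
          (mul_eq_zero.1 h0).resolve_left (clebschGordanWeight_pos l₁ l₂ m x).ne'
      · intro L _ hne
        by_contra hcon
        exact hne (by rw [clebschGordan_eq_zero fun h => hcon ⟨h.1, h.2.1⟩, mul_zero])
    · exact Finset.sum_eq_zero fun L _ => by rw [racahSum_eq_zero hmx, mul_zero]
  have hpair : ∀ j : ℕ, ∑ L ∈ t, c L * clebschGordanNorm l₁ l₂ L m *
      ∑ x ∈ Finset.Icc (-(l₁ : ℤ)) l₁, (x : ℝ) ^ j * racahSum l₁ l₂ L m x = 0 := by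
    intro j
    simp_rw [Finset.mul_sum]
    rw [Finset.sum_comm]
    refine Finset.sum_eq_zero fun x hx => ?_
    have := congrArg ((x : ℝ) ^ j * ·) (hsum x hx)
    simp only [Finset.mul_sum, mul_zero] at this
    rw [← this]
    exact Finset.sum_congr rfl fun L _ => by ring
  have main : ∀ j : ℕ, ∀ L ∈ t, j + L = l₁ + l₂ → c L = 0 := by
    intro j
    induction j using Nat.strong_induction_on with
    | _ j ih =>
      intro L hL hj
      have h0 := hpair j
      rw [Finset.sum_eq_single_of_mem L hL] at h0
      · exact (mul_eq_zero.1 ((mul_eq_zero.1 h0).resolve_right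
          (sum_pow_mul_racahSum_pos (hmem.1 hL).2.1 (hmem.1 hL).2.2 hj).ne')).resolve_right
          (clebschGordanNorm_pos l₁ l₂ L m).ne'
      · intro L' hL' hne
        have hle : L' ≤ l₁ + l₂ := (hmem.1 hL').2.1.2.2
        rcases lt_or_gt_of_ne hne with hlt | hgt
        · rw [sum_pow_mul_racahSum_of_lt m (by lia), mul_zero]
        · rw [ih (l₁ + l₂ - L') (by lia) L' hL' (by lia), zero_mul, zero_mul]
  exact main (l₁ + l₂ - L) L (hmem.2 ⟨hL, ht, hm⟩) (by have := ht.2.2; lia)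

/-- For fixed `l`, the vectors `m ↦ C_{l_1 m_1 … l_{n+1} m_{n+1}}^{λ_1 … λ_n, μ}` indexed by the
coupling paths `λ` and by `μ` are linearly independent. -/
theorem genClebschGordan_independent : ∀ (n : ℕ) (l : Fin (n + 1) → ℕ) (s : Finset (Fin n → ℕ))
    (c : (Fin n → ℕ) → ℤ → ℝ), (∀ lam ∈ s, CouplingPath n l lam) →
    (∀ m : Fin (n + 1) → ℤ, (∀ i, |m i| ≤ l i) →
      ∑ lam ∈ s, ∑ μ ∈ Finset.Icc (-(endMomentum n l lam : ℤ)) (endMomentum n l lam),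
        c lam μ * genClebschGordan n l m lam μ = 0) →
    ∀ lam ∈ s, ∀ μ : ℤ, |μ| ≤ endMomentum n l lam → c lam μ = 0
  | 0, l, s, c, _, h, lam, hlam, μ, hμ => by
    have hs : s = {lam} :=
      Finset.eq_singleton_iff_unique_mem.2 ⟨hlam, fun _ _ => Subsingleton.elim _ _⟩
    have h0 := h (fun _ => μ) fun i => by
      rw [Fin.fin_one_eq_zero i]
      exact hμ
    rw [hs, Finset.sum_singleton] at h0
    have hmem : μ ∈ Finset.Icc (-(endMomentum 0 l lam : ℤ)) (endMomentum 0 l lam) :=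
      Finset.mem_Icc.2 (abs_le.1 hμ)
    simpa [genClebschGordan, Finset.sum_ite_eq', hmem] using h0
  | n + 1, l, s, c, hs, h, lam₀, hlam₀, μ₀, hμ₀ => by
    classical
    set l' : Fin (n + 1) → ℕ := Fin.init l
    set j : ℕ := l (Fin.last (n + 1)) with hj
    have key : ∀ (mj : ℤ), |mj| ≤ j → ∀ lam' ∈ s.image (Fin.init : _ → (Fin n → ℕ)), ∀ μ' : ℤ,
        |μ'| ≤ endMomentum n l' lam' →
        ∑ lam ∈ s with Fin.init lam = lam',
          ∑ μ ∈ Finset.Icc (-(lam (Fin.last n) : ℤ)) (lam (Fin.last n)),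
            c lam μ * clebschGordan (endMomentum n l' lam') μ' j mj (lam (Fin.last n)) μ = 0 := by
      intro mj hmj
      refine genClebschGordan_independent n l' _ _ (fun lam' hlam' => ?_) fun m' hm' => ?_
      · obtain ⟨lam, hlam, rfl⟩ := Finset.mem_image.1 hlam'
        exact (hs lam hlam).1
      · have h0 := h (Fin.snoc (α := fun _ => ℤ) m' mj) fun i => by
          refine Fin.lastCases ?_ (fun i => ?_) i
          · simpa using hmj
          · simpa [l', Fin.init] using hm' i
        rw [← Finset.sum_fiberwise_of_maps_to
          (fun lam hlam => Finset.mem_image_of_mem Fin.init hlam)] at h0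
        rw [← h0]
        refine Finset.sum_congr rfl fun lam' _ => ?_
        simp_rw [Finset.sum_mul]
        rw [Finset.sum_comm]
        refine Finset.sum_congr rfl fun lam hlam => ?_
        have hinit : (Fin.init lam : Fin n → ℕ) = lam' := (Finset.mem_filter.1 hlam).2
        subst hinit
        rw [Finset.sum_comm]
        refine Finset.sum_congr rfl fun μ _ => ?_
        rw [genClebschGordan, Finset.mul_sum]
        refine Finset.sum_congr rfl fun μ' _ => ?_
        rw [Fin.init_snoc, Fin.snoc_last]
        ring
    set lam' : Fin n → ℕ := Fin.init lam₀ with hlam'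
    set t : Finset ℕ := (s.filter fun lam => Fin.init lam = lam').image fun lam => lam (Fin.last n)
    have hsnoc : ∀ lam ∈ s.filter (fun lam => Fin.init lam = lam'),
        Fin.snoc (α := fun _ => ℕ) lam' (lam (Fin.last n)) = lam := by
      intro lam hlam
      rw [← (Finset.mem_filter.1 hlam).2, Fin.snoc_init_self]
    have h1 := clebschGordan_independent (l₁ := endMomentum n l' lam') (l₂ := j) (m := μ₀) t
      (fun L => c (Fin.snoc (α := fun _ => ℕ) lam' L) μ₀) (fun x hx hmx => ?_)
      (L := lam₀ (Fin.last n)) (Finset.mem_image.2 ⟨lam₀, by simp [hlam₀, hlam'], rfl⟩)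
      (hs lam₀ hlam₀).2 hμ₀
    · simpa [hlam'] using h1
    · rw [← key (μ₀ - x) hmx lam' (Finset.mem_image_of_mem _ hlam₀) x hx, Finset.sum_image]
      · refine Finset.sum_congr rfl fun lam hlam => ?_
        simp only [hsnoc lam hlam]
        by_cases hμ : μ₀ ∈ Finset.Icc (-(lam (Fin.last n) : ℤ)) (lam (Fin.last n))
        · rw [Finset.sum_eq_single_of_mem μ₀ hμ]
          intro μ _ hne
          rw [clebschGordan_eq_zero fun h => hne (by linarith [h.2.2]), mul_zero]
        · rw [clebschGordan_eq_zero fun h => hμ (Finset.mem_Icc.2 (abs_le.1 h.2.1)), mul_zero]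
          refine (Finset.sum_eq_zero fun μ hμ' => ?_).symm
          rw [clebschGordan_eq_zero fun h => hμ ?_, mul_zero]
          rwa [show μ₀ = μ by linarith [h.2.2]]
      · intro a ha b hb hab
        rw [← hsnoc a ha, ← hsnoc b hb]
        exact congrArg _ hab

lemma CouplingPath.endMomentum_le : ∀ {n : ℕ} {l : Fin (n + 1) → ℕ} {lam : Fin n → ℕ},
    CouplingPath n l lam → endMomentum n l lam ≤ ∑ i, l i
  | 0, l, _, _ => by simp [endMomentum]
  | n + 1, l, lam, h => by
    have h1 := h.1.endMomentum_le
    have h2 := h.2.2.2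
    rw [Fin.sum_univ_castSucc]
    exact h2.trans (Nat.add_le_add_right h1 _)

lemma CouplingPath.apply_le : ∀ {n : ℕ} {l : Fin (n + 1) → ℕ} {lam : Fin n → ℕ},
    CouplingPath n l lam → ∀ i, lam i ≤ ∑ i, l i
  | 0, _, _, _ => fun i => i.elim0
  | n + 1, l, lam, h => fun i => by
    refine Fin.lastCases (h.endMomentum_le) (fun i => ?_) i
    rw [Fin.sum_univ_castSucc]
    exact (h.1.apply_le i).trans (Nat.le_add_right _ _)

lemma mem_admissibleSet : ∀ {p : ℕ} {l : Fin p → ℕ} {lam : Fin (p - 3) → ℕ},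
    lam ∈ admissibleSet p l ↔ Admissible p l lam := by
  intro p l lam
  simp only [admissibleSet, Finset.mem_filter, Fintype.mem_piFinset, Finset.mem_range,
    Nat.lt_succ_iff, and_iff_right_iff_imp]
  match p, l, lam with
  | 0, _, _ => exact fun h => h.elim
  | 1, _, _ => exact fun h => h.elim
  | 2, _, _ => exact fun _ i => i.elim0
  | k + 3, l, lam =>
    intro h i
    have := CouplingPath.apply_le h (Fin.castSucc i)
    rw [Fin.snoc_castSucc] at this
    rw [Fin.sum_univ_castSucc]
    exact this.trans (Nat.le_add_right _ _)

/-- The vectors `m ↦ C_{l_1 m_1 … l_{p-1} m_{p-1}}^{λ_1 … λ_{p-3} l_p, -m_p}`, indexed by the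
admissible `λ`, are linearly independent. -/
theorem polyCoupling_independent {p : ℕ} {l : Fin p → ℕ} (c : (Fin (p - 3) → ℕ) → ℝ)
    (h : ∀ m : Fin p → ℤ, (∀ i, |m i| ≤ l i) →
      ∑ lam ∈ admissibleSet p l, polyCoupling p l m lam * c lam = 0)
    {lam : Fin (p - 3) → ℕ} (hlam : Admissible p l lam) : c lam = 0 := by
  classical
  match p, l, c, h, lam, hlam with
  | 0, _, _, _, _, hlam => exact hlam.elim
  | 1, _, _, _, _, hlam => exact hlam.elim
  | 2, l, c, h, lam, hlam =>
    have hs : admissibleSet 2 l = {lam} := Finset.eq_singleton_iff_unique_mem.2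
      ⟨mem_admissibleSet.2 hlam, fun x _ => funext fun i => i.elim0⟩
    have h0 := h 0 (by simp)
    have hl : l 0 = l 1 := hlam
    rw [hs, Finset.sum_singleton] at h0
    simpa [polyCoupling, hl] using h0
  | k + 3, l, c, h, lam, hlam =>
    set e : (Fin k → ℕ) → (Fin (k + 1) → ℕ) :=
      fun lam => Fin.snoc (α := fun _ => ℕ) lam (l (Fin.last (k + 2)))
    have he : Function.Injective e := fun a b hab => by
      simpa [e] using congrArg Fin.init hab
    have hend : ∀ lam, endMomentum (k + 1) (Fin.init l) (e lam) = l (Fin.last (k + 2)) :=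
      fun lam => Fin.snoc_last (α := fun _ => ℕ) _ lam
    have h1 := genClebschGordan_independent (k + 1) (Fin.init l) ((admissibleSet (k + 3) l).image e)
      (fun lam' μ => if μ = 0 then c (Fin.init lam') else 0) ?_ ?_ (e lam)
      (Finset.mem_image_of_mem e (mem_admissibleSet.2 hlam)) 0 (by simp)
    · simpa [e] using h1
    · intro lam' hlam'
      obtain ⟨lam, hlam, rfl⟩ := Finset.mem_image.1 hlam'
      exact mem_admissibleSet.1 hlam
    · intro m hm
      have h0 := h (Fin.snoc (α := fun _ => ℤ) m 0) fun i => by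
        refine Fin.lastCases (by simp) (fun i => ?_) i
        simpa [Fin.init] using hm i
      rw [Finset.sum_image he.injOn]
      refine Eq.trans (Finset.sum_congr rfl fun lam _ => ?_) h0
      rw [hend, Finset.sum_eq_single_of_mem 0 (by simp) fun μ _ hμ => by simp [hμ]]
      simp [polyCoupling, e, mul_comm]

end ClebschGordan

/-! ### Functions with moments of all orders -/

section AllMoments

variable {X Ω : Type*} [MeasurableSpace X] [MeasurableSpace Ω] {𝕜 : Type*} [RCLike 𝕜]

/-- The function `f` belongs to `L^q(μ)` for every natural number `q`. -/
def AllMoments {E : Type*} [NormedAddCommGroup E] (f : X → E) (μ : Measure X) : Prop :=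
  ∀ q : ℕ, MemLp f q μ

lemma AllMoments.aestronglyMeasurable {E : Type*} [NormedAddCommGroup E] {f : X → E}
    {μ : Measure X} (hf : AllMoments f μ) : AEStronglyMeasurable f μ := (hf 0).1

lemma AllMoments.integrable {E : Type*} [NormedAddCommGroup E] {f : X → E}
    {μ : Measure X} (hf : AllMoments f μ) : Integrable f μ := by
  simpa using memLp_one_iff_integrable.1 (by simpa using hf 1)

lemma AllMoments.norm {E : Type*} [NormedAddCommGroup E] {f : X → E}
    {μ : Measure X} (hf : AllMoments f μ) : AllMoments (fun x => ‖f x‖) μ :=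
  fun q => (hf q).norm

lemma AllMoments.add {E : Type*} [NormedAddCommGroup E] {f g : X → E}
    {μ : Measure X} (hf : AllMoments f μ) (hg : AllMoments g μ) :
    AllMoments (fun x => f x + g x) μ :=
  fun q => (hf q).add (hg q)

lemma AllMoments.sum {E ι : Type*} [NormedAddCommGroup E] {f : ι → X → E} {μ : Measure X}
    (s : Finset ι) (hf : ∀ i ∈ s, AllMoments (f i) μ) :
    AllMoments (fun x => ∑ i ∈ s, f i x) μ :=
  fun q => memLp_finsetSum s fun i hi => hf i hi q

lemma allMoments_const {E : Type*} [NormedAddCommGroup E] (μ : Measure X) [IsFiniteMeasure μ]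
    (c : E) : AllMoments (fun _ => c) μ :=
  fun _ => memLp_const c

lemma AllMoments.mul {f g : X → 𝕜} {μ : Measure X} (hf : AllMoments f μ) (hg : AllMoments g μ) :
    AllMoments (fun x => f x * g x) μ := by
  intro q
  have hpq : ENNReal.HolderTriple ((2 * q : ℕ) : ENNReal) ((2 * q : ℕ) : ENNReal) q := by
    constructor
    rcases Nat.eq_zero_or_pos q with rfl | hq
    · simp
    · push_cast
      rw [ENNReal.mul_inv (by simp) (by simp), ← add_mul, ENNReal.inv_two_add_inv_two, one_mul]
  exact (hg (2 * q)).mul (hf (2 * q))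

lemma AllMoments.prod {ι : Type*} {f : ι → X → 𝕜} {μ : Measure X} [IsFiniteMeasure μ]
    (s : Finset ι) (hf : ∀ i ∈ s, AllMoments (f i) μ) :
    AllMoments (fun x => ∏ i ∈ s, f i x) μ := by
  classical
  induction s using Finset.induction_on with
  | empty => simpa using allMoments_const μ (1 : 𝕜)
  | insert a s ha ih =>
    simp_rw [Finset.prod_insert ha]
    exact (hf a (Finset.mem_insert_self _ _)).mul
      (ih fun i hi => hf i (Finset.mem_insert_of_mem hi))

lemma AllMoments.comp_measurePreserving {Y E : Type*} [MeasurableSpace Y] [NormedAddCommGroup E]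
    {f : Y → E} {ν : Measure Y} {μ : Measure X} (hf : AllMoments f ν) {g : X → Y}
    (hg : MeasurePreserving g μ ν) : AllMoments (fun x => f (g x)) μ :=
  fun q => (hf q).comp_measurePreserving hg

lemma allMoments_of_lintegral_lt_top {E : Type*} [NormedAddCommGroup E] {σ : Measure X}
    {μ : Measure Ω} [SFinite μ] {G : X × Ω → E}
    (hG : AEStronglyMeasurable G (σ.prod μ))
    (h : ∀ q : ℕ, ∫⁻ x, ∫⁻ ω, ‖G (x, ω)‖ₑ ^ q ∂μ ∂σ < ⊤) : AllMoments G (σ.prod μ) := by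
  intro q
  rcases Nat.eq_zero_or_pos q with rfl | hq
  · simpa using hG
  refine ⟨hG, ?_⟩
  rw [eLpNorm_lt_top_iff_lintegral_rpow_enorm_lt_top (by simpa using hq.ne') (by simp)]
  simp only [ENNReal.toReal_natCast, ENNReal.rpow_natCast]
  rw [lintegral_prod _ (by fun_prop)]
  exact h q

variable {σ : Measure X} [IsFiniteMeasure σ] {μ : Measure Ω} [IsFiniteMeasure μ]

lemma AllMoments.comp_eval_prod {ι E : Type*} [Fintype ι] [NormedAddCommGroup E] {G : X × Ω → E}
    (hG : AllMoments G (σ.prod μ)) (i : ι) :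
    AllMoments (fun z : (ι → X) × Ω => G (z.1 i, z.2)) ((Measure.pi fun _ => σ).prod μ) := by
  classical
  intro q
  have hmap : ((Measure.pi fun _ : ι => σ).prod μ).map (Prod.map (Function.eval i) id) =
      (∏ j ∈ Finset.univ.erase i, σ Set.univ) • σ.prod μ := by
    rw [← Measure.map_prod_map _ _ (measurable_pi_apply i) measurable_id, Measure.map_id,
      Measure.pi_map_eval, Measure.prod_smul_left]
  have hmeas : Measurable (Prod.map (Function.eval i) id : (ι → X) × Ω → X × Ω) :=
    (measurable_pi_apply i).prodMap measurable_id
  refine MemLp.comp_of_map (f := (Prod.map (Function.eval i) id : (ι → X) × Ω → X × Ω)) (g := G) ?_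
    hmeas.aemeasurable
  rw [hmap]
  exact (hG q).smul_measure (ENNReal.prod_ne_top fun _ _ => measure_ne_top _ _)

lemma AllMoments.prod_eval {ι : Type*} [Fintype ι] {G : ι → X × Ω → 𝕜}
    (hG : ∀ i, AllMoments (G i) (σ.prod μ)) :
    AllMoments (fun z : (ι → X) × Ω => ∏ i, G i (z.1 i, z.2)) ((Measure.pi fun _ => σ).prod μ) :=
  AllMoments.prod _ fun i _ => (hG i).comp_eval_prod i

/-- Fubini's theorem for a product of integrals depending on a common parameter. -/
lemma integral_prod_integral {ι : Type*} [Fintype ι] {G : ι → X × Ω → 𝕜}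
    (hG : ∀ i, AllMoments (G i) (σ.prod μ)) :
    ∫ ω, ∏ i, ∫ x, G i (x, ω) ∂σ ∂μ =
      ∫ x : ι → X, ∫ ω, ∏ i, G i (x i, ω) ∂μ ∂(Measure.pi fun _ => σ) := by
  rw [integral_integral_swap (AllMoments.prod_eval hG).integrable]
  congr 1 with ω
  exact (integral_fintype_prod_eq_prod (fun i x => G i (x, ω))).symm

lemma AllMoments.integral_left {G : X × Ω → 𝕜} (hG : AllMoments G (σ.prod μ)) :
    AllMoments (fun ω => ∫ x, G (x, ω) ∂σ) μ := by
  have hmeas : AEStronglyMeasurable (fun ω => ∫ x, G (x, ω) ∂σ) μ :=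
    hG.aestronglyMeasurable.prod_swap.integral_prod_right'
  intro q
  rcases Nat.eq_zero_or_pos q with rfl | hq
  · simpa using hmeas
  have h1 :=
    (AllMoments.prod_eval (𝕜 := ℝ) (fun _ : Fin q => hG.norm)).integrable.integral_prod_right
  have h2 : Integrable (fun ω => (∫ x, ‖G (x, ω)‖ ∂σ) ^ q) μ := by
    refine h1.congr (Filter.Eventually.of_forall fun ω => ?_)
    have := integral_fintype_prod_eq_prod (μ := fun _ : Fin q => σ)
      (fun (_ : Fin q) x => ‖G (x, ω)‖)
    simpa using this
  rw [← integrable_norm_rpow_iff hmeas (by simpa using hq.ne') (by simp)]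
  simp only [ENNReal.toReal_natCast, Real.rpow_natCast]
  refine h2.mono (by fun_prop) (Filter.Eventually.of_forall fun ω => ?_)
  simp only [norm_pow, norm_norm]
  gcongr
  exact (norm_integral_le_integral_norm _).trans (le_abs_self _)

lemma AllMoments.lintegral_lt_top {E : Type*} [NormedAddCommGroup E] {G : X × Ω → E}
    (hG : AllMoments G (σ.prod μ)) (q : ℕ) : ∫⁻ x, ∫⁻ ω, ‖G (x, ω)‖ₑ ^ q ∂μ ∂σ < ⊤ := by
  have hm := hG.aestronglyMeasurable
  rcases Nat.eq_zero_or_pos q with rfl | hq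
  · simpa using ENNReal.mul_lt_top (measure_lt_top _ _) (measure_lt_top _ _)
  have := (hG q).2
  rw [eLpNorm_lt_top_iff_lintegral_rpow_enorm_lt_top (by simpa using hq.ne') (by simp)] at this
  simp only [ENNReal.toReal_natCast, ENNReal.rpow_natCast] at this
  rwa [lintegral_prod _ (by fun_prop)] at this

end AllMoments

/-! ### Joint cumulants -/

section JointCumulant

variable {Ω Ω' : Type*} [MeasurableSpace Ω] [MeasurableSpace Ω'] {μ : Measure Ω} {μ' : Measure Ω'}
  {p : ℕ}

lemma jointCumulant_eq_setCumulant (X : Fin p → Ω → ℂ) :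
    jointCumulant μ X = setCumulant (fun b => ∫ ω, ∏ i ∈ b, X i ω ∂μ) Finset.univ := by
  rw [setCumulant_eq_sum_finpartition]
  rfl

lemma jointCumulant_congr_moments {X : Fin p → Ω → ℂ} {Y : Fin p → Ω' → ℂ}
    (h : ∀ b : Finset (Fin p), ∫ ω, ∏ i ∈ b, X i ω ∂μ = ∫ ω, ∏ i ∈ b, Y i ω ∂μ') :
    jointCumulant μ X = jointCumulant μ' Y := by
  simp only [jointCumulant, h]

lemma jointCumulant_congr_ae {X Y : Fin p → Ω → ℂ} (h : ∀ i, X i =ᵐ[μ] Y i) :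
    jointCumulant μ X = jointCumulant μ Y := by
  refine jointCumulant_congr_moments fun b => integral_congr_ae ?_
  filter_upwards [ae_all_iff.2 h] with ω hω
  exact Finset.prod_congr rfl fun i _ => hω i

/-- Joint cumulants are additive on independent random vectors. -/
lemma jointCumulant_add [IsProbabilityMeasure μ] (hp : p ≠ 0) {X Y : Fin p → Ω → ℂ}
    (hX : ∀ i, AllMoments (X i) μ) (hY : ∀ i, AllMoments (Y i) μ)
    (h : IndepFun (fun ω i => X i ω) (fun ω i => Y i ω) μ) :
    jointCumulant μ (fun i ω => X i ω + Y i ω) = jointCumulant μ X + jointCumulant μ Y := by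
  simp only [jointCumulant_eq_setCumulant]
  refine setCumulant_convolution (by simp) (by simp) (fun b => ?_) ?_
  · simp_rw [Finset.prod_add]
    have hint : ∀ Z : Fin p → Ω → ℂ, (∀ i, AllMoments (Z i) μ) → ∀ c : Finset (Fin p),
        AllMoments (fun ω => ∏ i ∈ c, Z i ω) μ := fun Z hZ c => AllMoments.prod c fun i _ => hZ i
    rw [integral_finsetSum _ fun c _ => ((hint X hX c).mul (hint Y hY (b \ c))).integrable]
    refine Finset.sum_congr rfl fun c _ => ?_
    have hc : ∀ c : Finset (Fin p), Measurable fun z : Fin p → ℂ => ∏ i ∈ c, z i := by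
      intro c
      fun_prop
    exact (h.comp (hc c) (hc (b \ c))).integral_mul_eq_mul_integral
      (hint X hX c).aestronglyMeasurable (hint Y hY (b \ c)).aestronglyMeasurable
  · have : NeZero p := ⟨hp⟩
    exact Finset.univ_nonempty

/-- Joint cumulants of order at least two are invariant under translation. -/
lemma jointCumulant_add_const [IsProbabilityMeasure μ] (hp : 2 ≤ p) {X : Fin p → Ω → ℂ}
    (hX : ∀ i, AllMoments (X i) μ) (c : Fin p → ℂ) :
    jointCumulant μ (fun i ω => X i ω + c i) = jointCumulant μ X := by
  rw [jointCumulant_add (by lia) hX (fun i => allMoments_const μ (c i)) (indepFun_const_right _ _)]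
  have : jointCumulant μ (fun i _ => c i) = 0 := by
    rw [jointCumulant_eq_setCumulant]
    simpa using setCumulant_prod_eq_zero c (b := Finset.univ) (by simpa using hp)
  rw [this, add_zero]

/-- The joint cumulant of a sum of i.i.d. copies of a random vector. -/
lemma jointCumulant_sum_pi {ι : Type*} [Fintype ι] [IsProbabilityMeasure μ] (hp : p ≠ 0)
    {X : Fin p → Ω → ℂ} (hX : ∀ i, AllMoments (X i) μ) :
    jointCumulant (Measure.pi fun _ : ι => μ) (fun i ω => ∑ j, X i (ω j)) =
      Fintype.card ι * jointCumulant μ X := by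
  classical
  have heval : ∀ j : ι, MeasurePreserving (Function.eval j) (Measure.pi fun _ : ι => μ) μ :=
    fun j => measurePreserving_eval (fun _ => μ) j
  have hXj : ∀ (j : ι) i, AllMoments (fun ω : ι → Ω => X i (ω j)) (Measure.pi fun _ => μ) :=
    fun j i => (hX i).comp_measurePreserving (heval j)
  have hXm : AEMeasurable (fun ω i => X i ω) μ :=
    aemeasurable_pi_lambda _ fun i => (hX i).aestronglyMeasurable.aemeasurable
  have hind : iIndepFun (fun (j : ι) (ω : ι → Ω) i => X i (ω j)) (Measure.pi fun _ => μ) :=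
    iIndepFun_pi (X := fun _ ω i => X i ω) fun _ => hXm
  suffices h : ∀ s : Finset ι, jointCumulant (Measure.pi fun _ : ι => μ)
      (fun i ω => ∑ j ∈ s, X i (ω j)) = s.card * jointCumulant μ X from h Finset.univ
  intro s
  induction s using Finset.induction_on with
  | empty =>
    have h0 := jointCumulant_add (μ := Measure.pi fun _ : ι => μ) hp
      (X := fun i _ => (0 : ℂ)) (Y := fun i _ => 0) (fun _ => allMoments_const _ _)
      (fun _ => allMoments_const _ _) (indepFun_const_right _ _)
    simpa using h0
  | insert j s hj ih =>
    simp_rw [Finset.sum_insert hj]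
    rw [jointCumulant_add hp (hXj j) (fun i => AllMoments.sum s fun j _ => hXj j i), ih,
      Finset.card_insert_of_notMem hj]
    · have : jointCumulant (Measure.pi fun _ : ι => μ) (fun i ω => X i (ω j)) =
          jointCumulant μ X := by
        refine jointCumulant_congr_moments fun b => ?_
        have hmeas : AEStronglyMeasurable (fun ω => ∏ i ∈ b, X i ω)
            ((Measure.pi fun _ : ι => μ).map (Function.eval j)) := by
          rw [(heval j).map_eq]
          exact (AllMoments.prod b fun i _ => hX i).aestronglyMeasurable
        have := integral_map (heval j).aemeasurable hmeas
        rw [(heval j).map_eq] at this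
        exact this.symm
      rw [this]
      push_cast
      ring
    · have := (hind.indepFun_finsetSum_of_notMem₀
        (fun j => hXm.comp_quasiMeasurePreserving (heval j).quasiMeasurePreserving) hj).symm
      convert this using 1
      ext ω i
      simp

end JointCumulant

/-! ### Harmonic coefficients -/

section HarmonicCoefficients

instance : IsFiniteMeasure surfaceMeasure := by
  unfold surfaceMeasure
  infer_instance

lemma continuous_assocLegendre (l m : ℕ) : Continuous (assocLegendre l m) := by
  unfold assocLegendre
  fun_prop

lemma measurable_sphericalHarmonicNonneg (l m : ℕ) :
    Measurable (sphericalHarmonicNonneg l m) := by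
  have h0 : ∀ i : Fin 3, Measurable fun x : S2 => x.1 i := fun i => by fun_prop
  have harg : Measurable fun x : S2 => Complex.arg ⟨x.1 0, x.1 1⟩ := by
    refine Complex.measurable_arg.comp ?_
    have : (fun x : S2 => (⟨x.1 0, x.1 1⟩ : ℂ)) =
        fun x : S2 => (x.1 0 : ℂ) + (x.1 1 : ℂ) * Complex.I := by
      ext x
      exact (Complex.mk_eq_add_mul_I _ _)
    rw [this]
    fun_prop
  have hleg : Measurable fun x : S2 => assocLegendre l m (x.1 2) :=
    (continuous_assocLegendre l m).measurable.comp (h0 2)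
  unfold sphericalHarmonicNonneg
  fun_prop

lemma exists_norm_sphericalHarmonicNonneg_le (l m : ℕ) :
    ∃ K : ℝ, ∀ x, ‖sphericalHarmonicNonneg l m x‖ ≤ K := by
  have hc : Continuous fun x : S2 => assocLegendre l m (x.1 2) :=
    (continuous_assocLegendre l m).comp (by fun_prop)
  obtain ⟨K, hK⟩ := (isCompact_range hc).isBounded.exists_norm_le
  refine ⟨|Real.sqrt ((2 * l + 1) / (4 * Real.pi) *
      (((l - m).factorial : ℝ) / ((l + m).factorial : ℝ)))| * K, fun x => ?_⟩
  have hexp : ‖Complex.exp (Complex.I * m * Complex.arg ⟨x.1 0, x.1 1⟩)‖ = 1 := by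
    rw [show Complex.I * m * Complex.arg ⟨x.1 0, x.1 1⟩ =
      ((m * Complex.arg ⟨x.1 0, x.1 1⟩ : ℝ) : ℂ) * Complex.I by push_cast; ring]
    exact Complex.norm_exp_ofReal_mul_I _
  rw [sphericalHarmonicNonneg, norm_mul, norm_mul, hexp, mul_one, Complex.norm_real,
    Complex.norm_real, Real.norm_eq_abs]
  gcongr
  exact hK _ ⟨x, rfl⟩

lemma measurable_sphericalHarmonic (l : ℕ) (m : ℤ) : Measurable (sphericalHarmonic l m) := by
  have := measurable_sphericalHarmonicNonneg l m.natAbs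
  unfold sphericalHarmonic
  split_ifs
  · exact this
  · exact (Complex.continuous_conj.measurable.comp this).const_mul _

lemma exists_norm_sphericalHarmonic_le (l : ℕ) (m : ℤ) :
    ∃ K : ℝ, ∀ x, ‖sphericalHarmonic l m x‖ ≤ K := by
  obtain ⟨K, hK⟩ := exists_norm_sphericalHarmonicNonneg_le l m.natAbs
  refine ⟨K, fun x => ?_⟩
  unfold sphericalHarmonic
  split_ifs
  · exact hK x
  · simpa using hK x

lemma allMoments_conj_sphericalHarmonic {Ω : Type*} [MeasurableSpace Ω] (μ : Measure Ω)
    [IsFiniteMeasure μ] (l : ℕ) (m : ℤ) :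
    AllMoments (fun z : S2 × Ω => (starRingEnd ℂ) (sphericalHarmonic l m z.1))
      (surfaceMeasure.prod μ) := by
  obtain ⟨K, hK⟩ := exists_norm_sphericalHarmonic_le l m
  intro q
  refine MemLp.of_bound ?_ K (Filter.Eventually.of_forall fun z => ?_)
  · exact (Complex.continuous_conj.measurable.comp
      ((measurable_sphericalHarmonic l m).comp measurable_fst)).aestronglyMeasurable
  · simpa using hK z.1

variable {Ω Ω' : Type*} [MeasurableSpace Ω] [MeasurableSpace Ω'] {μ : Measure Ω} {μ' : Measure Ω'}
  {T : S2 → Ω → ℝ} {T' : S2 → Ω' → ℝ}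

lemma EqualInLaw.fintype (h : EqualInLaw T μ T' μ') {ι : Type*} [Fintype ι] (x : ι → S2) :
    IdentDistrib (fun ω i => T (x i) ω) (fun ω i => T' (x i) ω) μ μ' := by
  have e := Fintype.equivFin ι
  have h1 := (h (Fintype.card ι) (x ∘ e.symm)).comp
    (u := fun (y : Fin (Fintype.card ι) → ℝ) i => y (e i)) (by fun_prop)
  simpa [Function.comp_def] using h1

variable [IsProbabilityMeasure μ] [IsProbabilityMeasure μ']

/-- The field `T` belongs to `L^q(dx ⊗ μ)` for every natural number `q`. -/
def FieldMoments {Ω : Type*} [MeasurableSpace Ω] (T : S2 → Ω → ℝ) (μ : Measure Ω) : Prop :=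
  AllMoments (fun z : S2 × Ω => T z.1 z.2) (surfaceMeasure.prod μ)

lemma FieldMoments.mul_conj_sphericalHarmonic (hT : FieldMoments T μ) (l : ℕ) (m : ℤ) :
    AllMoments (fun z : S2 × Ω => (T z.1 z.2 : ℂ) * (starRingEnd ℂ) (sphericalHarmonic l m z.1))
      (surfaceMeasure.prod μ) :=
  AllMoments.mul (fun q => (hT q).ofReal) (allMoments_conj_sphericalHarmonic μ l m)

lemma FieldMoments.harmonicCoeff (hT : FieldMoments T μ) (l : ℕ) (m : ℤ) :
    AllMoments (harmonicCoeff T l m) μ :=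
  (hT.mul_conj_sphericalHarmonic l m).integral_left

lemma FieldMoments.finiteSpectralMoments (hT : FieldMoments T μ) (p : ℕ) :
    FiniteSpectralMoments T μ p :=
  fun l m _ => hT.harmonicCoeff l m p

lemma EqualInLaw.fieldMoments (h : EqualInLaw T μ T' μ')
    (hm : Measurable fun z : S2 × Ω => T z.1 z.2) (hT' : FieldMoments T' μ') :
    FieldMoments T μ := by
  refine allMoments_of_lintegral_lt_top hm.aestronglyMeasurable fun q => ?_
  refine lt_of_eq_of_lt (lintegral_congr fun x => ?_) (hT'.lintegral_lt_top q)
  have := (h.fintype fun _ : Unit => x).comp (u := fun y => ‖y ()‖ₑ ^ q) (by fun_prop)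
  exact this.lintegral_eq

lemma EqualInLaw.integral_prod_harmonicCoeff (h : EqualInLaw T μ T' μ') (hT : FieldMoments T μ)
    (hT' : FieldMoments T' μ') {ι : Type*} (b : Finset ι) (l : ι → ℕ) (m : ι → ℤ) :
    ∫ ω, ∏ i ∈ b, harmonicCoeff T (l i) (m i) ω ∂μ =
      ∫ ω, ∏ i ∈ b, harmonicCoeff T' (l i) (m i) ω ∂μ' := by
  simp_rw [← Finset.prod_coe_sort b]
  refine (integral_prod_integral (ι := b)
    fun i => hT.mul_conj_sphericalHarmonic (l i) (m i)).trans (Eq.trans ?_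
    (integral_prod_integral (ι := b)
      fun i => hT'.mul_conj_sphericalHarmonic (l i) (m i)).symm)
  congr 1 with x
  exact ((h.fintype x).comp (u := fun y => ∏ i : b,
    (y i : ℂ) * (starRingEnd ℂ) (sphericalHarmonic (l i) (m i) (x i))) (by fun_prop)).integral_eq

/-- The cumulant polyspectrum depends only on the finite-dimensional distributions. -/
lemma EqualInLaw.cumulantPolyspectrum_eq (h : EqualInLaw T μ T' μ') (hT : FieldMoments T μ)
    (hT' : FieldMoments T' μ') {p : ℕ} (l : Fin p → ℕ) (m : Fin p → ℤ) :
    cumulantPolyspectrum T μ l m = cumulantPolyspectrum T' μ' l m :=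
  jointCumulant_congr_moments fun b => h.integral_prod_harmonicCoeff hT hT' b l m

end HarmonicCoefficients

/-! ### Isotropic Gaussian fields and chi-square fields -/

section ChiSquareFields

lemma det_reflection_orthogonal_span {v : E3} (hv : v ≠ 0) :
    LinearMap.det ((ℝ ∙ v)ᗮ.reflection.toLinearEquiv : E3 →ₗ[ℝ] E3) = -1 := by
  have := (ℝ ∙ v)ᗮ.det_reflection
  rw [Submodule.orthogonal_orthogonal, finrank_span_singleton hv, pow_one] at this
  exact this

/-- The rotation group acts transitively on the sphere. -/
lemma exists_rotation (x y : S2) : ∃ g : E3 ≃ₗᵢ[ℝ] E3,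
    LinearMap.det (g.toLinearEquiv : E3 →ₗ[ℝ] E3) = 1 ∧ moveBy g x = y := by
  rcases eq_or_ne x y with rfl | hxy
  · refine ⟨LinearIsometryEquiv.refl ℝ E3, ?_, Subtype.ext rfl⟩
    exact LinearMap.det_id
  have hne : x.1 - y.1 ≠ 0 := sub_ne_zero.2 fun h => hxy (Subtype.ext h)
  obtain ⟨v, hv, hv0⟩ : ∃ v ∈ (ℝ ∙ x.1)ᗮ, v ≠ 0 := by
    refine Submodule.exists_mem_ne_zero_of_ne_bot fun hbot => ?_
    have h1 := (ℝ ∙ x.1).finrank_add_finrank_orthogonal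
    rw [hbot, finrank_bot, finrank_euclideanSpace_fin] at h1
    have h2 := finrank_span_le_card (R := ℝ) ({x.1} : Set E3)
    simp at h2
    lia
  refine ⟨(ℝ ∙ v)ᗮ.reflection.trans (ℝ ∙ (x.1 - y.1))ᗮ.reflection, ?_, Subtype.ext ?_⟩
  · have := LinearMap.det_comp ((ℝ ∙ (x.1 - y.1))ᗮ.reflection.toLinearEquiv : E3 →ₗ[ℝ] E3)
      ((ℝ ∙ v)ᗮ.reflection.toLinearEquiv : E3 →ₗ[ℝ] E3)
    rw [det_reflection_orthogonal_span hne, det_reflection_orthogonal_span hv0] at this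
    exact this.trans (by norm_num)
  · have hfix : (ℝ ∙ v)ᗮ.reflection x.1 = x.1 := by
      rw [Submodule.reflection_eq_self_iff, Submodule.mem_orthogonal_singleton_iff_inner_right,
        real_inner_comm]
      exact Submodule.mem_orthogonal_singleton_iff_inner_right.1 hv
    have hnorm : ‖x.1‖ = ‖y.1‖ := by simp
    change (ℝ ∙ (x.1 - y.1))ᗮ.reflection ((ℝ ∙ v)ᗮ.reflection x.1) = y.1
    rw [hfix, Submodule.reflection_sub hnorm]

variable {Ω Ω' : Type*} [MeasurableSpace Ω] [MeasurableSpace Ω'] {μ : Measure Ω} {μ' : Measure Ω'}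
  {T : S2 → Ω → ℝ}

lemma FieldMoments.sq (hT : FieldMoments T μ) : FieldMoments (fun x ω => T x ω ^ 2) μ := by
  simpa only [FieldMoments, pow_two] using AllMoments.mul hT hT

variable [IsProbabilityMeasure μ] [IsProbabilityMeasure μ']

lemma IsIsotropicGaussianField.fieldMoments (hT : IsIsotropicGaussianField T μ) :
    FieldMoments T μ := by
  refine allMoments_of_lintegral_lt_top hT.measurable.aestronglyMeasurable fun q => ?_
  obtain ⟨x₀⟩ : Nonempty S2 := (NormedSpace.sphere_nonempty.2 zero_le_one).to_subtype
  have hconst : ∀ x, ∫⁻ ω, ‖T x ω‖ₑ ^ q ∂μ = ∫⁻ ω, ‖T x₀ ω‖ₑ ^ q ∂μ := by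
    intro x
    obtain ⟨g, hg, hgx⟩ := exists_rotation x x₀
    have := ((hT.isotropic g hg).fintype fun _ : Unit => x).comp
      (u := fun y => ‖y ()‖ₑ ^ q) (by fun_prop)
    rw [← hgx]
    exact this.lintegral_eq
  simp only [hconst, lintegral_const]
  refine ENNReal.mul_lt_top ?_ (measure_lt_top _ _)
  have hmem : MemLp (T x₀) q μ := (hT.gaussian.hasGaussianLaw_eval x₀).memLp (by simp)
  rcases Nat.eq_zero_or_pos q with rfl | hq
  · simp
  · have := hmem.2
    rw [eLpNorm_lt_top_iff_lintegral_rpow_enorm_lt_top (by simpa using hq.ne') (by simp)] at this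
    simpa using this

lemma FieldMoments.add_const (hT : FieldMoments T μ) (c : ℝ) :
    FieldMoments (fun x ω => T x ω + c) μ :=
  AllMoments.add hT (allMoments_const _ c)

lemma FieldMoments.ae_integrable (hT : FieldMoments T μ) (l : ℕ) (m : ℤ) :
    ∀ᵐ ω ∂μ, Integrable (fun x => (T x ω : ℂ) * (starRingEnd ℂ) (sphericalHarmonic l m x))
      surfaceMeasure :=
  (hT.mul_conj_sphericalHarmonic l m).integrable.prod_left_ae

/-- Adding a constant to a field does not change its cumulants of order at least two. -/
lemma FieldMoments.cumulantPolyspectrum_add_const (hT : FieldMoments T μ) (c : ℝ) {p : ℕ}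
    (hp : 2 ≤ p) (l : Fin p → ℕ) (m : Fin p → ℤ) :
    cumulantPolyspectrum (fun x ω => T x ω + c) μ l m = cumulantPolyspectrum T μ l m := by
  rw [cumulantPolyspectrum, cumulantPolyspectrum,
    ← jointCumulant_add_const hp (fun i => hT.harmonicCoeff (l i) (m i))
      fun i => ∫ x, (c : ℂ) * (starRingEnd ℂ) (sphericalHarmonic (l i) (m i) x) ∂surfaceMeasure]
  refine jointCumulant_congr_ae fun i => ?_
  have hc : FieldMoments (fun _ _ => c) μ := allMoments_const _ c
  filter_upwards [hT.ae_integrable (l i) (m i), hc.ae_integrable (l i) (m i)] with ω h1 h2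
  rw [ChiSquarePolyspectra.harmonicCoeff, ChiSquarePolyspectra.harmonicCoeff,
    ← integral_add h1 h2]
  simp [add_mul]

/-- The sum of independent copies of the field `T`, on a product space. -/
def sumCopies (ι : Type*) [Fintype ι] (T : S2 → Ω → ℝ) (x : S2) (ω : ι → Ω) : ℝ :=
  ∑ j, T x (ω j)

lemma FieldMoments.sumCopies (ι : Type*) [Fintype ι] (hT : FieldMoments T μ) :
    FieldMoments (sumCopies ι T) (Measure.pi fun _ => μ) := by
  refine AllMoments.sum _ fun j _ => ?_
  have heval : MeasurePreserving (Function.eval j) (Measure.pi fun _ : ι => μ) μ :=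
    measurePreserving_eval (fun _ => μ) j
  exact AllMoments.comp_measurePreserving hT
    ((MeasurePreserving.id surfaceMeasure).prod heval)

lemma FieldMoments.cumulantPolyspectrum_sumCopies (ι : Type*) [Fintype ι] (hT : FieldMoments T μ)
    {p : ℕ} (hp : p ≠ 0) (l : Fin p → ℕ) (m : Fin p → ℤ) :
    cumulantPolyspectrum (ChiSquarePolyspectra.sumCopies ι T) (Measure.pi fun _ => μ) l m =
      Fintype.card ι * cumulantPolyspectrum T μ l m := by
  rw [cumulantPolyspectrum, cumulantPolyspectrum,
    ← jointCumulant_sum_pi hp fun i => hT.harmonicCoeff (l i) (m i)]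
  refine jointCumulant_congr_ae fun i => ?_
  have h : ∀ j : ι, ∀ᵐ ω ∂(Measure.pi fun _ : ι => μ),
      Integrable (fun x => (T x (ω j) : ℂ) * (starRingEnd ℂ) (sphericalHarmonic (l i) (m i) x))
        surfaceMeasure :=
    fun j => (Measure.quasiMeasurePreserving_eval (fun _ => μ) j).ae
      (hT.ae_integrable (l i) (m i))
  filter_upwards [ae_all_iff.2 h] with ω hω
  simp only [ChiSquarePolyspectra.harmonicCoeff]
  rw [← integral_finsetSum _ fun j _ => hω j]
  simp [ChiSquarePolyspectra.sumCopies, Finset.sum_mul]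

/-- A sum of squares of i.i.d. fields has the law of the corresponding sum on a product space. -/
lemma equalInLaw_sum_sq_sumCopies {ι : Type*} [Fintype ι] {U : ι → S2 → Ω → ℝ} {V : S2 → Ω' → ℝ}
    (hU : ∀ j x, Measurable (U j x)) (hV : ∀ x, Measurable (V x))
    (hindep : iIndepFun (fun j ω x => U j x ω) μ) (hlaw : ∀ j, EqualInLaw (U j) μ V μ') :
    EqualInLaw (fun x ω => ∑ j, U j x ω ^ 2) μ (sumCopies ι fun x ω => V x ω ^ 2)
      (Measure.pi fun _ => μ') := by
  intro k x
  have hjoint : IdentDistrib (fun ω j i => U j (x i) ω) (fun (ω : ι → Ω') j i => V (x i) (ω j)) μ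
      (Measure.pi fun _ => μ') := by
    have hVm : Measurable fun (ω : ι → Ω') j i => V (x i) (ω j) :=
      measurable_pi_lambda _ fun j => measurable_pi_lambda _ fun i =>
        (hV (x i)).comp (measurable_pi_apply j)
    refine ⟨by fun_prop, hVm.aemeasurable, ?_⟩
    have h1 : iIndepFun (fun j ω i => U j (x i) ω) μ :=
      hindep.comp (fun _ (f : S2 → ℝ) i => f (x i)) fun _ => by fun_prop
    rw [(iIndepFun_iff_map_fun_eq_pi_map fun j => by fun_prop).1 h1,
      Measure.pi_map_pi (X := fun _ : ι => Ω') (f := fun _ ω i => V (x i) ω)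
        fun _ => by fun_prop]
    congr 1
    ext1 j
    exact (hlaw j k x).map_eq
  exact hjoint.comp (u := fun y i => ∑ j, y j i ^ 2) (by fun_prop)

lemma aeval_hermite_two (t : ℝ) : aeval t (hermite 2) = t ^ 2 + (-1) := by
  simp [hermite_succ, pow_two, sub_eq_add_neg]

end ChiSquareFields

end ChiSquarePolyspectra

open ChiSquarePolyspectra

/-- The fields `T 0, …, T (ν - 1)` are i.i.d. isotropic Gaussian fields, with the law of `TG`; `Tχ` is
a `χ²_ν` field, with the law of `∑ T_i²`; the reference field `F` is the `χ²_1` field `TG²`, or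
`H₂(TG) = TG² - 1`. -/
theorem mainTheorem11
    {Ω Ω' Ω'' : Type*} [MeasurableSpace Ω] [MeasurableSpace Ω'] [MeasurableSpace Ω'']
    (μ : MeasureTheory.Measure Ω) [MeasureTheory.IsProbabilityMeasure μ]
    (μ' : MeasureTheory.Measure Ω') [MeasureTheory.IsProbabilityMeasure μ']
    (μ'' : MeasureTheory.Measure Ω'') [MeasureTheory.IsProbabilityMeasure μ'']
    (ν : ℕ) (hν : 1 ≤ ν)
    (TG : ChiSquarePolyspectra.S2 → Ω'' → ℝ)
    (hTG : ChiSquarePolyspectra.IsIsotropicGaussianField TG μ'')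
    (T : Fin ν → ChiSquarePolyspectra.S2 → Ω → ℝ)
    (hT : ∀ i, ChiSquarePolyspectra.IsIsotropicGaussianField (T i) μ)
    (hindep : ProbabilityTheory.iIndepFun (fun i ω x => T i x ω) μ)
    (hlaw : ∀ i, ChiSquarePolyspectra.EqualInLaw (T i) μ TG μ'')
    (Tχ : ChiSquarePolyspectra.S2 → Ω' → ℝ)
    (hTχ : Measurable (fun q : ChiSquarePolyspectra.S2 × Ω' => Tχ q.1 q.2))
    (hχ : ChiSquarePolyspectra.EqualInLaw Tχ μ' (fun x ω => ∑ i, T i x ω ^ 2) μ)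
    (F : ChiSquarePolyspectra.S2 → Ω'' → ℝ)
    (hF : F = (fun x ω => TG x ω ^ 2) ∨
      F = (fun x ω => Polynomial.aeval (TG x ω) (Polynomial.hermite 2)))
    (p : ℕ) (hp : 2 ≤ p) :
    -- the cumulant polyspectra are well defined
    ChiSquarePolyspectra.FiniteSpectralMoments F μ'' p ∧
    ChiSquarePolyspectra.FiniteSpectralMoments Tχ μ' p ∧
    -- the vectors `S^c` are multiplied by `ν`
    (∀ (l : Fin p → ℕ) (m : Fin p → ℤ), (∀ i, |m i| ≤ l i) →
      ChiSquarePolyspectra.cumulantPolyspectrum Tχ μ' l m =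
        ν * ChiSquarePolyspectra.cumulantPolyspectrum F μ'' l m) ∧
    -- the reduced cumulant polyspectrum is multiplied by `ν`
    (∀ (l : Fin p → ℕ) (lam : Fin (p - 3) → ℕ), ChiSquarePolyspectra.Admissible p l lam →
      ChiSquarePolyspectra.reducedCumulantPolyspectrum Tχ μ' p l lam =
        ν * ChiSquarePolyspectra.reducedCumulantPolyspectrum F μ'' p l lam) ∧
    -- the same for the arrays given by the expansion of the cumulants: `A` expands the cumulants of
    -- `F` if and only if `ν A` expands those of `Tχ`, and there are no other such arrays
    (∀ A : (Fin p → ℕ) → (Fin (p - 3) → ℕ) → ℝ,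
      ChiSquarePolyspectra.IsReducedCumulantPolyspectrum F μ'' p A ↔
        ChiSquarePolyspectra.IsReducedCumulantPolyspectrum Tχ μ' p (fun l lam => ν * A l lam)) ∧
    (∀ A B : (Fin p → ℕ) → (Fin (p - 3) → ℕ) → ℝ,
      ChiSquarePolyspectra.IsReducedCumulantPolyspectrum F μ'' p A →
      ChiSquarePolyspectra.IsReducedCumulantPolyspectrum Tχ μ' p B →
      ∀ (l : Fin p → ℕ) (lam : Fin (p - 3) → ℕ), ChiSquarePolyspectra.Admissible p l lam →
        B l lam = ν * A l lam) := by
  have hG : FieldMoments TG μ'' := hTG.fieldMoments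
  have hG2 := hG.sq
  have hFmom : FieldMoments F μ'' ∧ ∀ (l : Fin p → ℕ) (m : Fin p → ℤ),
      cumulantPolyspectrum F μ'' l m = cumulantPolyspectrum (fun x ω => TG x ω ^ 2) μ'' l m := by
    rcases hF with rfl | rfl
    · exact ⟨hG2, fun _ _ => rfl⟩
    · simp only [aeval_hermite_two]
      exact ⟨hG2.add_const (-1), hG2.cumulantPolyspectrum_add_const (-1) hp⟩
  have hTm : ∀ j x, Measurable (T j x) := fun j x => (hT j).measurable.comp measurable_prodMk_left
  have hTGm : ∀ x, Measurable (TG x) := fun x => hTG.measurable.comp measurable_prodMk_left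
  have hcopies := equalInLaw_sum_sq_sumCopies hTm hTGm hindep hlaw
  have hχlaw : EqualInLaw Tχ μ' (sumCopies (Fin ν) fun x ω => TG x ω ^ 2)
      (MeasureTheory.Measure.pi fun _ => μ'') := fun k x => (hχ k x).trans (hcopies k x)
  have hχmom : FieldMoments Tχ μ' := hχlaw.fieldMoments hTχ (hG2.sumCopies (Fin ν))
  have hS : ∀ (l : Fin p → ℕ) (m : Fin p → ℤ),
      cumulantPolyspectrum Tχ μ' l m = ν * cumulantPolyspectrum F μ'' l m := by
    intro l m
    rw [hχlaw.cumulantPolyspectrum_eq hχmom (hG2.sumCopies (Fin ν)),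
      hG2.cumulantPolyspectrum_sumCopies (Fin ν) (by lia), hFmom.2, Fintype.card_fin]
  have hν0 : (ν : ℂ) ≠ 0 := by
    exact_mod_cast (show ν ≠ 0 by lia)
  have hiff : ∀ A : (Fin p → ℕ) → (Fin (p - 3) → ℕ) → ℝ, IsReducedCumulantPolyspectrum F μ'' p A ↔
      IsReducedCumulantPolyspectrum Tχ μ' p (fun l lam => ν * A l lam) := by
    intro A
    refine forall₃_congr fun l m _ => ?_
    rw [hS, ← mul_right_inj' hν0]
    refine Eq.congr_right ?_
    rw [mul_left_comm, Finset.mul_sum]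
    refine congrArg _ (Finset.sum_congr rfl fun lam _ => ?_)
    push_cast
    ring
  refine ⟨hFmom.1.finiteSpectralMoments p, hχmom.finiteSpectralMoments p, fun l m _ => hS l m,
    fun l lam _ => ?_, hiff, fun A B hA hB l lam hlam => ?_⟩
  · simp only [reducedCumulantPolyspectrum, hS, Finset.mul_sum]
    exact Finset.sum_congr rfl fun m _ => by ring
  · refine sub_eq_zero.1 (polyCoupling_independent (fun lam => B l lam - ν * A l lam)
      (fun m hm => ?_) hlam)
    have h1 := (hB l m hm).symm.trans ((hiff A).1 hA l m hm)
    have h2 := mul_left_cancel₀ (zpow_ne_zero _ (by norm_num)) h1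
    norm_cast at h2
    simp only [mul_sub, Finset.sum_sub_distrib]
    exact sub_eq_zero.2 (by exact_mod_cast h2)
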